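/- **Setting.** Let $d\ge 1$. Each isometry $g$ of $\mathbb R^d$ is written $g\cdot x=\mathrm{rot}(g)x+\mathrm{trans}(g)$ with $\mathrm{rot}(g)\in O(d)$. Let $\mathcal G$ be a space group, i.e. a group of isometries of $\mathbb R^d$ all of whose orbits are discrete and which contains $d$ translations with linearly independent translation vectors. Let $x_0\in\mathbb R^d$ be such that $g\mapsto g\cdot x_0$ is injective on $\mathcal G$. Let $\mathcal T$ be the group of translations in $\mathcal G$ and $\mathcal T^N=\{t^N:t\in\mathcal T\}$. A function $u$ on $\mathcal G$ is $\mathcal T^N$-periodic if $u(gt)=u(g)$ for all $g\in\mathcal G$, $t\in\mathcal T^N$, and periodic if it is $\mathcal T^N$-periodic for some integer $N\ge1$. Let $U_{\mathrm{per}}$ be the space of periodic $u:\mathcal G\to\mathbb R^d$ with the uniform norm, and let $\mathcal C_N$ be a (finite) set of representatives of $\mathcal G/\mathcal T^N$. *Seminorms.* Let $\mathcal R\subset\mathcal G$ be finite and suppose that there are $\mathcal R',\mathcal R''\subset\mathcal G$ with $\mathcal R'\mathcal R''\subset\mathcal R$ such that $\mathrm{id}\in\mathcal R'$, $\mathcal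 R'$ generates $\mathcal G$, $\mathcal R''$ is finite, $\mathrm{id}\in\mathcal R''$, and $\mathcal R''\cdot x_0$ and $\mathcal G\cdot x_0$ have the same affine hull. For a space $K$ of skew-symmetric $d\times d$ matrices let $U_K(\mathcal R)$ be the set of all $v:\mathcal R\to\mathbb R^d$ for which there are $a\in\mathbb R^d$ and $S\in K$ with $\mathrm{rot}(g)v(g)=a+S(g\cdot x_0-x_0)$ for all $g\in\mathcal R$, and let $\pi_K$ be the orthogonal projection of the Euclidean space $(\mathbb R^d)^{\mathcal R}$ with kernel $U_K(\mathcal R)$. For $\mathcal T^N$-periodic $u$ put $$\|u\|_K=\Big(\frac1{|\mathcal C_N|}\sum_{g\in\mathcal C_N}\big\|\pi_K\big(u(g\,\cdot)|_{\mathcal R}\big)\big\|^2\Big)^{1/2}.$$ Let $\|\cdot\|_{\mathcal R}=\|\cdot\|_{\mathrm{Skew}(d)}$ and $\|\cdot\|_{\mathcal R,0,0}=\|\cdot\|_{\{0\}}$. (In general, $\|\cdot\|_{\mathcal R,0,0}$ is formed with the skew-symmetric matrices supported in the upper left $d_1\times d_1$ block, where $d=d_1+d_2$; for a space group $d_1=0$.)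 *Energy.* Let $V:(\mathbb R^d)^{\mathcal G\setminus\{\mathrm{id}\}}\to\mathbb R$ satisfy: $V(Ay)=V(y)$ for all $A\in O(d)$ and all $y$; for each $y$ the map $z\mapsto V(y+z)$ is twice continuously Fréchet differentiable on $L^\infty(\mathcal G\setminus\{\mathrm{id}\},\mathbb R^d)$; and $V$ has finite interaction range, i.e. there is a finite set $\mathcal R_V\subset\mathcal G\setminus\{\mathrm{id}\}$ such that $V(y)$ depends only on $y|_{\mathcal R_V}$. For $\mathcal T^N$-periodic $w\in U_{\mathrm{per}}$ let $$E(w)=\frac1{|\mathcal C_N|}\sum_{g\in\mathcal C_N}V\Big(\big((gh)\cdot w(gh)-g\cdot w(g)\big)_{h\in\mathcal G\setminus\{\mathrm{id}\}}\Big).$$ **Theorem.** The function $E$ is twice continuously Fréchet differentiable on $U_{\mathrm{per}}$ with respect to the uniform norm. Let $E''$ denote its second derivative at the constant function $x_0$ (the identity deformation). Then $E''$ is bounded with respect to both $\|\cdot\|_{\mathcal R}$ and $\|\cdot\|_{\mathcal R,0,0}$: for each of these two seminorms $p$ there is a constant $C>0$ such that $|E''(u,v)|\le C\,p(u)\,p(v)$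 for all $u,v\in U_{\mathrm{per}}$. Moreover, both stability constants $$\lambda_{\mathrm a}=\sup\{c\in\mathbb R:\ c\|u\|_{\mathcal R}^2\le E''(u,u)\ \forall u\in U_{\mathrm{per}}\},\qquad \lambda_{\mathrm a,0,0}=\sup\{c\in\mathbb R:\ c\|u\|_{\mathcal R,0,0}^2\le E''(u,u)\ \forall u\in U_{\mathrm{per}}\},$$ which are defined in $[-\infty,\infty]$ with $\sup\emptyset=-\infty$, are real numbers. -/

import Mathlib

open scoped ENNReal

noncomputable section

namespace ObjStruct

/-- The Euclidean space `ℝ^d`. -/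
abbrev Pt (d : ℕ) : Type := EuclideanSpace ℝ (Fin d)

/-- The Euclidean group `E(d)`: all isometries of `ℝ^d`, with composition as multiplication. -/
abbrev EucGroup (d : ℕ) : Type := Pt d ≃ᵃⁱ[ℝ] Pt d

/-- The linear component `rot g ∈ O(d)` of a Euclidean isometry `g x = (rot g) x + trans g`. -/
abbrev rot {d : ℕ} (g : EucGroup d) : Pt d ≃ₗᵢ[ℝ] Pt d := g.linearIsometryEquiv

/-- A subgroup of `E(d)` is discrete if each of its orbits is a discrete set. -/
def IsDiscreteGroup {d : ℕ} (G : Subgroup (EucGroup d)) : Prop :=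
  ∀ x : Pt d, IsDiscrete (Set.range fun g : G => (g : EucGroup d) x)

/-- A space group: a discrete subgroup of `E(d)` that contains `d` translations whose
translation components are linearly independent. -/
def IsSpaceGroup {d : ℕ} (G : Subgroup (EucGroup d)) : Prop :=
  IsDiscreteGroup G ∧
    ∃ b : Fin d → Pt d, LinearIndependent ℝ b ∧
      ∀ i, AffineIsometryEquiv.constVAdd ℝ (Pt d) (b i) ∈ G

section Periodicity

variable {d : ℕ} (G : Subgroup (EucGroup d))

theorem rot_mul (g h : EucGroup d) : rot (g * h) = rot g * rot h := rfl

/-- The subgroup `T` of the translations in `G`. -/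
def translations : Subgroup G where
  carrier := {t | rot (t : EucGroup d) = 1}
  one_mem' := rfl
  mul_mem' := by
    intro a b ha hb
    change rot ((a : EucGroup d) * (b : EucGroup d)) = 1
    rw [rot_mul, ha, hb, one_mul]
  inv_mem' := by
    intro a ha
    have h : rot (a : EucGroup d) * rot ((a : EucGroup d)⁻¹) = 1 := by
      rw [← rot_mul, mul_inv_cancel]; rfl
    change rot ((a : EucGroup d)⁻¹) = 1
    rwa [show rot (a : EucGroup d) = 1 from ha, one_mul] at h

theorem apply_of_rot_eq_one {g : EucGroup d} (hg : rot g = 1) (x : Pt d) : g x = x + g 0 := by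
  have h := g.map_vadd 0 x
  rw [show g.linearIsometryEquiv = 1 from hg] at h
  simpa using h

theorem translations_commute {s t : G} (hs : s ∈ translations G) (ht : t ∈ translations G) :
    Commute s t := by
  apply Subtype.ext
  apply AffineIsometryEquiv.ext
  intro x
  change (s : EucGroup d) ((t : EucGroup d) x) = (t : EucGroup d) ((s : EucGroup d) x)
  rw [apply_of_rot_eq_one ht x, apply_of_rot_eq_one hs x, apply_of_rot_eq_one hs (x + _),
    apply_of_rot_eq_one ht (x + _), add_right_comm]

/-- The subgroup `T^N = {t^N : t ∈ T}` of `G`. -/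
def transPow (N : ℕ) : Subgroup G where
  carrier := {g | ∃ t ∈ translations G, t ^ N = g}
  one_mem' := ⟨1, one_mem _, one_pow _⟩
  mul_mem' := by
    rintro _ _ ⟨s, hs, rfl⟩ ⟨t, ht, rfl⟩
    exact ⟨s * t, mul_mem hs ht, (translations_commute G hs ht).mul_pow N⟩
  inv_mem' := by
    rintro _ ⟨s, hs, rfl⟩
    exact ⟨s⁻¹, inv_mem hs, inv_pow s N⟩

/-- `T^N`-periodicity of a function on `G`. -/
def IsPeriodicWith {S : Type*} (N : ℕ) (f : G → S) : Prop :=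
  ∀ g : G, ∀ t ∈ transPow G N, f g = f (g * t)

/-- A function on `G` is periodic if it is `T^N`-periodic for some positive integer `N`. (For a
space group, `T^N` is a normal subgroup of finite index for every positive `N`.) -/
def IsPeriodic {S : Type*} (f : G → S) : Prop :=
  ∃ N : ℕ, 0 < N ∧ IsPeriodicWith G N f

/-- `|C_N|⁻¹ ∑_{g ∈ C_N} f g`, where `C_N` is a set of representatives of `G / T^N`. -/
def cellMean (N : ℕ) (f : G → ℝ) : ℝ :=
  (Nat.card (G ⧸ transPow G N) : ℝ)⁻¹ * ∑ᶠ q : G ⧸ transPow G N, f q.out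

open Classical in
/-- The mean value of a periodic function: `|C_N|⁻¹ ∑_{g ∈ C_N} f g` for any positive `N` such
that `f` is `T^N`-periodic (the value does not depend on `N` and `C_N`). The value for functions
that are not periodic is irrelevant. -/
def mean (f : G → ℝ) : ℝ :=
  if h : IsPeriodic G f then cellMean G h.choose f else 0

theorem IsPeriodicWith.mul_right {S : Type*} {N : ℕ} {f : G → S} (hf : IsPeriodicWith G N f)
    (M : ℕ) : IsPeriodicWith G (N * M) f := by
  rintro g _ ⟨t, ht, rfl⟩
  exact hf g _ ⟨t ^ M, pow_mem ht M, by rw [← pow_mul, mul_comm]⟩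

/-- The space `U_per` of periodic functions `G → ℝ^d` as a subspace of `L^∞(G, ℝ^d)`; its norm is
the uniform norm. (For a space group each periodic function has finitely many values, so
that membership in `L^∞` excludes no periodic function.) -/
def Uper : Submodule ℝ (lp (fun _ : G => Pt d) ∞) where
  carrier := {u | IsPeriodic G (u : G → Pt d)}
  zero_mem' := ⟨1, one_pos, fun _ _ _ => rfl⟩
  add_mem' := by
    rintro u v ⟨N, hN, hu⟩ ⟨M, hM, hv⟩
    refine ⟨N * M, Nat.mul_pos hN hM, fun g t ht => ?_⟩
    have h1 := hu.mul_right G M g t ht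
    have h2 := hv.mul_right G N g t (by rwa [mul_comm] at ht)
    simp only [lp.coeFn_add, Pi.add_apply, h1.symm, h2.symm]
  smul_mem' := by
    rintro c u ⟨N, hN, hu⟩
    refine ⟨N, hN, fun g t ht => ?_⟩
    simp only [lp.coeFn_smul, Pi.smul_apply, hu g t ht]

/-- The value `u g ∈ ℝ^d` of `u ∈ U_per` at `g ∈ G`. -/
def Uper.val {G : Subgroup (EucGroup d)} (u : Uper G) (g : G) : Pt d :=
  (u : lp (fun _ : G => Pt d) ∞) g

/-- The constant function with value `x`, an element of `U_per`. -/
def constU (x : Pt d) : Uper G :=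
  ⟨⟨fun _ => x, memℓp_infty ⟨‖x‖, by rintro _ ⟨_, rfl⟩; exact le_rfl⟩⟩,
    ⟨1, one_pos, fun _ _ _ => rfl⟩⟩

end Periodicity

section Seminorms

variable {d : ℕ} {G : Subgroup (EucGroup d)}

/-- The space `Skew(d)` of skew-symmetric matrices. -/
def skew (d : ℕ) : Submodule ℝ (Matrix (Fin d) (Fin d) ℝ) where
  carrier := {S | S.transpose = -S}
  zero_mem' := by simp
  add_mem' := by
    intro A B hA hB
    change (A + B).transpose = -(A + B)
    rw [Matrix.transpose_add, show A.transpose = -A from hA, show B.transpose = -B from hB,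
      neg_add]
  smul_mem' := by
    intro c A hA
    change (c • A).transpose = -(c • A)
    rw [Matrix.transpose_smul, show A.transpose = -A from hA, smul_neg]

/-- The space `Skew_{0,0}(d)` with respect to the splitting `d = d₁ + d₂`: the skew-symmetric
matrices all of whose entries outside the upper left `d₁ × d₁` block vanish. -/
def skewZeroZero (d d₁ : ℕ) : Submodule ℝ (Matrix (Fin d) (Fin d) ℝ) where
  carrier := {S | S ∈ skew d ∧ ∀ i j : Fin d, d₁ ≤ (i : ℕ) ∨ d₁ ≤ (j : ℕ) → S i j = 0}
  zero_mem' := ⟨zero_mem _, fun _ _ _ => rfl⟩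
  add_mem' := by
    rintro A B ⟨hA, hA'⟩ ⟨hB, hB'⟩
    exact ⟨add_mem hA hB, fun i j h => by simp [hA' i j h, hB' i j h]⟩
  smul_mem' := by
    rintro c A ⟨hA, hA'⟩
    exact ⟨Submodule.smul_mem _ c hA, fun i j h => by simp [hA' i j h]⟩

/-- The space of all functions `R → ℝ^d` for a finite `R ⊆ G`, with its Euclidean norm
`(∑_{g ∈ R} ‖u g‖²)^{1/2}`. -/
abbrev LocalFun (R : Finset G) : Type := PiLp 2 fun _ : R => Pt d

/-- `U_trans(R)`: the `u : R → ℝ^d` with `rot(g) u(g) = a` for some `a ∈ ℝ^d` and all `g`. -/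
def Utrans (R : Finset G) : Submodule ℝ (LocalFun R) where
  carrier := {u | ∃ a : Pt d, ∀ g : R, rot ((g : G) : EucGroup d) (u g) = a}
  zero_mem' := ⟨0, fun g => by simp⟩
  add_mem' := by
    rintro u v ⟨a, ha⟩ ⟨b, hb⟩
    exact ⟨a + b, fun g => by rw [PiLp.add_apply, map_add, ha, hb]⟩
  smul_mem' := by
    rintro c u ⟨a, ha⟩
    exact ⟨c • a, fun g => by rw [PiLp.smul_apply, map_smul, ha]⟩

/-- For a space `K` of matrices: the `u : R → ℝ^d` such that, for some `S ∈ K`,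
`rot(g) u(g) = S (g·x₀ - x₀)` for all `g`. The choices `K = Skew(d)` and `K = Skew_{0,0}(d)` give
`U_rot(R)` and `U_{rot,0,0}(R)`. -/
def Urot (K : Submodule ℝ (Matrix (Fin d) (Fin d) ℝ)) (x₀ : Pt d) (R : Finset G) :
    Submodule ℝ (LocalFun R) where
  carrier := {u | ∃ S ∈ K, ∀ g : R, rot ((g : G) : EucGroup d) (u g) =
    Matrix.toEuclideanLin S (((g : G) : EucGroup d) x₀ - x₀)}
  zero_mem' := ⟨0, zero_mem _, fun g => by simp⟩
  add_mem' := by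
    rintro u v ⟨S, hS, hu⟩ ⟨T, hT, hv⟩
    exact ⟨S + T, add_mem hS hT, fun g => by
      rw [PiLp.add_apply, map_add, hu, hv, map_add, LinearMap.add_apply]⟩
  smul_mem' := by
    rintro c u ⟨S, hS, hu⟩
    exact ⟨c • S, Submodule.smul_mem _ c hS, fun g => by
      rw [PiLp.smul_apply, map_smul, hu, map_smul, LinearMap.smul_apply]⟩

/-- The space `U_trans(R) + U_rot(R)`, resp. `U_trans(R) + U_{rot,0,0}(R)`, for `K = Skew(d)`,
resp. `K = Skew_{0,0}(d)`. -/
def Uiso (K : Submodule ℝ (Matrix (Fin d) (Fin d) ℝ)) (x₀ : Pt d) (R : Finset G) :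
    Submodule ℝ (LocalFun R) :=
  Utrans R ⊔ Urot K x₀ R

/-- The restriction `u(g ·)|_R`. -/
def localRestrict (R : Finset G) (u : Uper G) (g : G) : LocalFun R :=
  WithLp.toLp 2 fun h : R => u.val (g * h)

/-- `(|C_N|⁻¹ ∑_{g ∈ C_N} ‖π(u(g ·)|_R)‖²)^{1/2}`, where `π` is the orthogonal projection with
kernel `U_trans(R) + U_{rot,K}(R)`, i.e. onto the orthogonal complement of that space. -/
def rigidSeminorm (K : Submodule ℝ (Matrix (Fin d) (Fin d) ℝ)) (x₀ : Pt d) (R : Finset G)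
    (u : Uper G) : ℝ :=
  Real.sqrt (mean G fun g => ‖(Uiso K x₀ R)ᗮ.starProjection (localRestrict R u g)‖ ^ 2)

/-- The seminorm `‖u‖_R`. -/
def seminormR (x₀ : Pt d) (R : Finset G) (u : Uper G) : ℝ :=
  rigidSeminorm (skew d) x₀ R u

/-- The seminorm `‖u‖_{R,0,0}` with respect to the splitting `d = d₁ + d₂`. For a
space group `d₁ = 0`. -/
def seminormRZeroZero (d₁ : ℕ) (x₀ : Pt d) (R : Finset G) (u : Uper G) : ℝ :=
  rigidSeminorm (skewZeroZero d d₁) x₀ R u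

/-- Property 1 of a subset of `G`. -/
def PropertyOne (x₀ : Pt d) (R : Set G) : Prop :=
  R.Finite ∧ 1 ∈ R ∧
    affineSpan ℝ ((fun g : G => (g : EucGroup d) x₀) '' R) =
      affineSpan ℝ (Set.range fun g : G => (g : EucGroup d) x₀)

/-- Property 2 of a subset of `G`: it is finite and contains a product `R' R''` such that
`1 ∈ R'`, `R'` generates `G`, and `R''` has Property 1. -/
def PropertyTwo (x₀ : Pt d) (R : Set G) : Prop :=
  R.Finite ∧ ∃ R' R'' : Set G, 1 ∈ R' ∧ Subgroup.closure R' = ⊤ ∧ PropertyOne x₀ R'' ∧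
    ∀ a ∈ R', ∀ b ∈ R'', a * b ∈ R

end Seminorms

section Energy

variable {d : ℕ} {G : Subgroup (EucGroup d)}

/-- The index set `G \ {id}`. -/
abbrev NonId (G : Subgroup (EucGroup d)) : Type := {g : G // g ≠ 1}

/-- Invariance under `O(d)`: `V(A y) = V(y)` for all `A ∈ O(d)`. -/
def IsOrthInvariant (V : (NonId G → Pt d) → ℝ) : Prop :=
  ∀ (A : Pt d ≃ₗᵢ[ℝ] Pt d) (y : NonId G → Pt d), V (fun g => A (y g)) = V y

/-- Smoothness: for each `y`, the function `z ↦ V(y + z)` is twice continuously Fréchet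
differentiable on `L^∞(G \ {id}, ℝ^d)`. -/
def IsSmoothPotential (V : (NonId G → Pt d) → ℝ) : Prop :=
  ∀ y : NonId G → Pt d,
    ContDiff ℝ 2 fun z : lp (fun _ : NonId G => Pt d) ∞ => V fun g => y g + z g

/-- `V` has finite interaction range: there is a finite `R_V ⊆ G \ {id}` such that
`V(y) = V(χ_{R_V} y)` for all `y`. -/
def HasFiniteRange (V : (NonId G → Pt d) → ℝ) : Prop :=
  ∃ RV : Set (NonId G), RV.Finite ∧ ∀ y : NonId G → Pt d, V y = V (RV.indicator y)

/-- The configurational energy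
`E(w) = |C_N|⁻¹ ∑_{g ∈ C_N} V(((gh)·w(gh) - g·w(g))_{h ∈ G \ {id}})`. -/
def energy (V : (NonId G → Pt d) → ℝ) (w : Uper G) : ℝ :=
  mean G fun g => V fun h : NonId G =>
    ((g * (h : G) : G) : EucGroup d) (w.val (g * h)) - (g : EucGroup d) (w.val g)

/-- `E''(χ_G x₀)`: the second Fréchet derivative, with respect to the uniform norm, of the energy
at the constant function `x₀`, which represents the identity deformation. -/
def energyHess (V : (NonId G → Pt d) → ℝ) (x₀ : Pt d) : Uper G →L[ℝ] Uper G →L[ℝ] ℝ :=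
  fderiv ℝ (fderiv ℝ (energy V)) (constU G x₀)

/-- Boundedness of a bilinear form with respect to a seminorm. -/
def BoundedWrt (B : Uper G →L[ℝ] Uper G →L[ℝ] ℝ) (p : Uper G → ℝ) : Prop :=
  ∃ C : ℝ, 0 < C ∧ ∀ u v : Uper G, |B u v| ≤ C * p u * p v

/-- `sup {c ∈ ℝ | c p(u)² ≤ B(u,u) for all u ∈ U_per}`, as an extended real number. -/
def stabilityConst (B : Uper G →L[ℝ] Uper G →L[ℝ] ℝ) (p : Uper G → ℝ) : EReal :=
  sSup ((fun c : ℝ => (c : EReal)) '' {c : ℝ | ∀ u : Uper G, c * p u ^ 2 ≤ B u u})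

end Energy

end ObjStruct

end

namespace ObjStruct

/-! ### Space groups and their translation subgroups -/

section Group

variable {d : ℕ} {G : Subgroup (EucGroup d)}

/-! Invariance under `rot g` turns the site energy at `g` into a function of the vectors `h · w(gh)
- w(g)`, and finite range leaves a C² function `W` of finitely many discrete derivatives `rot(h)
w(gh) - w(g)`, shifted by the constants `h · 0`. Hence `energy V` is a bounded linear functional
(the mean), composed with the superposition operator of `W` on a space of bounded families, composed
with a continuous affine map. Superposition operators of C² functions on a finite-dimensional space
are C² for the uniform norm (`contDiff_lpComp`), and the chain rule bounds the Hessian by means of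
products of discrete derivatives (`energy_regular`).

It remains to bound the mean squares of discrete derivatives by `‖u‖_R²`, with constants independent
of the period (`controlled_diffCLM`). This is a Korn inequality. At each `g` choose a best
infinitesimally rigid displacement with skew linear part `S_g`. The structure of `R` makes the fits
at `g` and `gk` agree up to controlled errors, so that `u(g tᵢ) - u(g) - S_g bᵢ` is controlled for
the lattice translations `tᵢ` by `bᵢ`. Symmetrizing removes `S_g`; summation by parts, available
because translations commute, bounds the full gradient by its symmetric part
(`sum_cellMean_diff_sq_le`). Then `S_g` is controlled too, and so is every discrete derivative.
Cauchy–Schwarz gives boundedness for `‖·‖_R`, hence for the larger `‖·‖_{R,0,0}`.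

A bounded form has a stability constant at least `-C`; a Rayleigh quotient at any `u` of positive
seminorm bounds it above. Korn supplies such a `u`. -/

theorem coe_mul_apply (g h : G) (x : Pt d) :
    ((g * h : G) : EucGroup d) x = (g : EucGroup d) ((h : EucGroup d) x) := rfl

theorem coe_inv_apply_apply (g : G) (x : Pt d) :
    ((g⁻¹ : G) : EucGroup d) ((g : EucGroup d) x) = x := by
  rw [← coe_mul_apply, inv_mul_cancel]; rfl

theorem apply_sub_apply (g : EucGroup d) (x y : Pt d) : g x - g y = rot g (x - y) := by
  simpa using (g.map_vsub x y).symm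

theorem apply_eq_rot_add (g : EucGroup d) (x : Pt d) : g x = rot g x + g 0 := by
  rw [← sub_eq_iff_eq_add, apply_sub_apply, sub_zero]

theorem translations_conj {t : G} (ht : t ∈ translations G) (g : G) :
    g * t * g⁻¹ ∈ translations G := by
  change rot ((g : EucGroup d) * (t : EucGroup d) * (g : EucGroup d)⁻¹) = 1
  rw [rot_mul, rot_mul, show rot (t : EucGroup d) = 1 from ht, mul_one, ← rot_mul,
    mul_inv_cancel]
  rfl

instance transPow_normal (N : ℕ) : (transPow G N).Normal where
  conj_mem := by
    rintro _ ⟨t, ht, rfl⟩ g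
    exact ⟨g * t * g⁻¹, translations_conj ht g, conj_pow⟩

theorem transPow_mul_le (N M : ℕ) : transPow G (N * M) ≤ transPow G N := by
  rintro _ ⟨t, ht, rfl⟩
  exact ⟨t ^ M, pow_mem ht M, by rw [← pow_mul, mul_comm]⟩

theorem translation_pow_apply {t : G} (ht : t ∈ translations G) (n : ℕ) (x : Pt d) :
    ((t ^ n : G) : EucGroup d) x = x + n • (t : EucGroup d) 0 := by
  induction n generalizing x with
  | zero => simp
  | succ n ih =>
    rw [pow_succ, coe_mul_apply, ih, apply_of_rot_eq_one ht x, succ_nsmul, add_assoc,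
      add_comm (n • _)]

/-- The orbit of a point under a discrete group of isometries is separated. -/
theorem exists_orbit_separated (hG : IsDiscreteGroup G) (x : Pt d) :
    ∃ ε > 0, ∀ g h : G, (g : EucGroup d) x ≠ (h : EucGroup d) x →
      ε ≤ dist ((g : EucGroup d) x) ((h : EucGroup d) x) := by
  obtain ⟨U, hU, hUx⟩ := isDiscrete_iff_forall_mem_exists_isOpen.1 (hG x) x ⟨1, rfl⟩
  have hxU : x ∈ U := by
    have : x ∈ U ∩ Set.range fun g : G => (g : EucGroup d) x := by rw [hUx]; rfl
    exact this.1
  obtain ⟨ε, hε, hball⟩ := Metric.isOpen_iff.1 hU x hxU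
  refine ⟨ε, hε, fun g h hne => ?_⟩
  by_contra! hlt
  -- Moving the pair by the isometry `h⁻¹` replaces `h x` by `x`, so that isolation of the single
  -- point `x` gives a uniform gap.
  have h1 : ((h⁻¹ * g : G) : EucGroup d) x ∈ U := by
    apply hball
    rw [Metric.mem_ball, coe_mul_apply]
    conv_lhs => rw [← coe_inv_apply_apply h x]
    rwa [AffineIsometryEquiv.dist_map, coe_inv_apply_apply]
  have h2 : ((h⁻¹ * g : G) : EucGroup d) x ∈ ({x} : Set (Pt d)) := by
    rw [← hUx]; exact ⟨h1, _, rfl⟩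
  apply hne
  have h3 := congrArg (h : EucGroup d) (Set.mem_singleton_iff.1 h2)
  rwa [← coe_mul_apply, mul_inv_cancel_left] at h3

/-- The translation vectors of `G` form an additive group. -/
def translationVectors (G : Subgroup (EucGroup d)) : AddSubgroup (Pt d) where
  carrier := {v | AffineIsometryEquiv.constVAdd ℝ (Pt d) v ∈ G}
  zero_mem' := by
    change AffineIsometryEquiv.constVAdd ℝ (Pt d) 0 ∈ G
    rw [AffineIsometryEquiv.constVAdd_zero]
    exact G.one_mem
  add_mem' := by
    intro a b ha hb
    have h := G.mul_mem ha hb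
    have heq : AffineIsometryEquiv.constVAdd ℝ (Pt d) (a + b) =
        AffineIsometryEquiv.constVAdd ℝ (Pt d) a * AffineIsometryEquiv.constVAdd ℝ (Pt d) b := by
      ext1 x
      simp [add_assoc]
    rwa [← heq] at h
  neg_mem' := by
    intro a ha
    have h := G.inv_mem ha
    have heq : AffineIsometryEquiv.constVAdd ℝ (Pt d) (-a) =
        (AffineIsometryEquiv.constVAdd ℝ (Pt d) a)⁻¹ := by
      rw [eq_inv_iff_mul_eq_one]
      ext1 x
      simp
    rwa [← heq] at h

theorem constVAdd_mem_translations {v : Pt d}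
    (hv : AffineIsometryEquiv.constVAdd ℝ (Pt d) v ∈ G) :
    (⟨_, hv⟩ : G) ∈ translations G := by
  change rot (AffineIsometryEquiv.constVAdd ℝ (Pt d) v) = 1
  ext x : 1
  have := apply_sub_apply (AffineIsometryEquiv.constVAdd ℝ (Pt d) v) x 0
  simpa using this.symm

/-- Every coset contains an element whose inverse maps `x` into a fixed ball. The orbit is
separated, so it meets the ball in finitely many points, and by injectivity only finitely many group
elements arise. -/
theorem finite_quotient_transPow (hG : IsSpaceGroup G) {x : Pt d}
    (hx : Function.Injective fun g : G => (g : EucGroup d) x) {N : ℕ} (hN : 0 < N) :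
    Finite (G ⧸ transPow G N) := by
  obtain ⟨hdisc, b, hb, hbG⟩ := hG
  obtain ⟨ε, hε, hsep⟩ := exists_orbit_separated hdisc x
  let B := basisOfLinearIndependentOfCardEqFinrank' b hb (by simp)
  let O : Set (Pt d) := Set.range fun g : G => (g : EucGroup d) x
  have hOsep : O.Pairwise fun x y => ε ≤ dist x y := by
    rintro _ ⟨g, rfl⟩ _ ⟨h, rfl⟩ hne
    exact hsep g h hne
  have hOc : IsClosed O := Metric.isClosed_of_pairwise_le_dist hε hOsep
  -- After subtracting `N` times a lattice vector from a point, `N` times a fractional part with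
  -- respect to `B` remains; this radius bounds it.
  let K : Set (Pt d) := Metric.closedBall 0 (N * ∑ i, ‖B i‖)
  have hfin : (K ∩ O).Finite := by
    exact Metric.finite_isBounded_inter_isClosed (hdisc x) Metric.isBounded_closedBall hOc
  have hfin' : Finite {k : G | (k : EucGroup d) x ∈ K} := by
    refine (Set.Finite.preimage (f := fun g : G => (g : EucGroup d) x) hx.injOn hfin).subset ?_
    exact fun k hk => ⟨hk, k, rfl⟩
  -- The inverse enters because translations act on orbit points from the left while the cosets `g
  -- T^N` are formed on the right: `(t⁻ᴺ g⁻¹)⁻¹ = g tᴺ`.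
  refine Finite.of_surjective
    (fun k : {k : G | (k : EucGroup d) x ∈ K} => (QuotientGroup.mk (k : G)⁻¹ : G ⧸ transPow G N)) ?_
  intro q
  obtain ⟨g, rfl⟩ := QuotientGroup.mk_surjective q
  set y : Pt d := ((g⁻¹ : G) : EucGroup d) x with hy
  have hfloor : (ZSpan.floor B ((N : ℝ)⁻¹ • y) : Pt d) ∈ translationVectors G := by
    have hle : Submodule.span ℤ (Set.range B) ≤ (translationVectors G).toIntSubmodule := by
      rw [Submodule.span_le]
      rintro _ ⟨i, rfl⟩
      have : B i = b i := by simp [B]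
      rw [this]
      exact hbG i
    exact hle (ZSpan.floor B ((N : ℝ)⁻¹ • y)).2
  set v : Pt d := (ZSpan.floor B ((N : ℝ)⁻¹ • y) : Pt d)
  let t : G := ⟨_, hfloor⟩
  have ht : t ∈ translations G := constVAdd_mem_translations hfloor
  have ht' : t⁻¹ ^ N ∈ transPow G N := ⟨t⁻¹, inv_mem ht, rfl⟩
  have htv : ((t⁻¹ : G) : EucGroup d) 0 = -v := by
    have h := coe_inv_apply_apply t 0
    rw [apply_of_rot_eq_one (inv_mem ht : t⁻¹ ∈ translations G)] at h
    have h2 : (t : EucGroup d) 0 = v := by simp [t]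
    rw [h2] at h
    exact eq_neg_of_add_eq_zero_right h
  refine ⟨⟨t⁻¹ ^ N * g⁻¹, ?_⟩, ?_⟩
  · change ((t⁻¹ ^ N * g⁻¹ : G) : EucGroup d) x ∈ K
    rw [coe_mul_apply, translation_pow_apply (inv_mem ht), htv, ← hy, mem_closedBall_zero_iff]
    have hN' : (N : ℝ) ≠ 0 := by positivity
    have : y + N • -v = (N : ℝ) • ZSpan.fract B ((N : ℝ)⁻¹ • y) := by
      rw [ZSpan.fract_apply, smul_sub, smul_inv_smul₀ hN', smul_neg, ← sub_eq_add_neg,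
        Nat.cast_smul_eq_nsmul]
    rw [this, norm_smul, Real.norm_natCast]
    gcongr
    exact ZSpan.norm_fract_le _ _
  · apply QuotientGroup.eq.2
    simpa using ht'

end Group

/-! ### Mean values of periodic functions -/

section Mean

variable {d : ℕ} {G : Subgroup (EucGroup d)} {N M : ℕ}

theorem IsPeriodicWith.apply_out {S : Type*} {f : G → S} (hf : IsPeriodicWith G N f) (g : G) :
    f (QuotientGroup.mk g : G ⧸ transPow G N).out = f g := by
  obtain ⟨t, ht⟩ := QuotientGroup.mk_out_eq_mul (transPow G N) g
  rw [ht]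
  exact (hf g t t.2).symm

/-- Periodicity is under right multiplication, so a right shift preserves it only because `T^N` is
normal. -/
theorem IsPeriodicWith.shift {S : Type*} {f : G → S} (hf : IsPeriodicWith G N f) (k : G) :
    IsPeriodicWith G N fun g => f (g * k) := by
  intro g t ht
  have h := (transPow_normal N).conj_mem t ht k⁻¹
  beta_reduce
  rw [show g * t * k = g * k * (k⁻¹ * t * k⁻¹⁻¹) by group]
  exact hf _ _ h

theorem IsPeriodicWith.comp {S S' : Type*} {f : G → S} (hf : IsPeriodicWith G N f) (φ : S → S') :
    IsPeriodicWith G N fun g => φ (f g) := fun g t ht => congrArg φ (hf g t ht)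

theorem IsPeriodicWith.comp₂ {S S' S'' : Type*} {f : G → S} {f' : G → S'}
    (hf : IsPeriodicWith G N f) (hf' : IsPeriodicWith G N f') (φ : S → S' → S'') :
    IsPeriodicWith G N fun g => φ (f g) (f' g) := fun g t ht =>
  congrArg₂ φ (hf g t ht) (hf' g t ht)

theorem IsPeriodicWith.pi {ι : Type*} {S : ι → Type*} {f : G → ∀ i, S i}
    (hf : ∀ i, IsPeriodicWith G N fun g => f g i) : IsPeriodicWith G N f := fun g t ht =>
  funext fun i => hf i g t ht

theorem IsPeriodicWith.mul_left {S : Type*} {f : G → S} (hf : IsPeriodicWith G M f) (N : ℕ) :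
    IsPeriodicWith G (N * M) f := mul_comm M N ▸ hf.mul_right G N

section

variable [Finite (G ⧸ transPow G N)]

theorem cellMean_add (f f' : G → ℝ) :
    cellMean G N (fun g => f g + f' g) = cellMean G N f + cellMean G N f' := by
  rw [cellMean, finsum_add_distrib (Set.toFinite _) (Set.toFinite _), mul_add]
  rfl

theorem cellMean_const_mul (c : ℝ) (f : G → ℝ) :
    cellMean G N (fun g => c * f g) = c * cellMean G N f := by
  have := Fintype.ofFinite (G ⧸ transPow G N)
  simp only [cellMean, finsum_eq_sum_of_fintype, ← Finset.mul_sum]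
  ring

theorem cellMean_neg (f : G → ℝ) : cellMean G N (fun g => -f g) = -cellMean G N f := by
  simpa using cellMean_const_mul (N := N) (-1) f

theorem cellMean_sub (f f' : G → ℝ) :
    cellMean G N (fun g => f g - f' g) = cellMean G N f - cellMean G N f' := by
  simp only [sub_eq_add_neg, cellMean_add, cellMean_neg]

theorem cellMean_sum {ι : Type*} (s : Finset ι) (f : ι → G → ℝ) :
    cellMean G N (fun g => ∑ i ∈ s, f i g) = ∑ i ∈ s, cellMean G N (f i) := by
  classical
  induction s using Finset.induction_on with
  | empty => simp [cellMean]
  | insert i s hi ih => simp only [Finset.sum_insert hi, cellMean_add, ih]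

theorem cellMean_mono {f f' : G → ℝ} (h : ∀ g, f g ≤ f' g) :
    cellMean G N f ≤ cellMean G N f' := by
  have := Fintype.ofFinite (G ⧸ transPow G N)
  rw [cellMean, cellMean, finsum_eq_sum_of_fintype, finsum_eq_sum_of_fintype]
  gcongr
  apply h

theorem cellMean_const (c : ℝ) : cellMean G N (fun _ => c) = c := by
  have := Fintype.ofFinite (G ⧸ transPow G N)
  rw [cellMean, finsum_eq_sum_of_fintype, Finset.sum_const, Nat.card_eq_fintype_card,
    Finset.card_univ, nsmul_eq_mul, inv_mul_cancel_left₀]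
  exact Nat.cast_ne_zero.2 Fintype.card_ne_zero

theorem cellMean_nonneg {f : G → ℝ} (h : ∀ g, 0 ≤ f g) : 0 ≤ cellMean G N f :=
  (cellMean_const (G := G) (N := N) 0).symm.le.trans (cellMean_mono h)

theorem abs_cellMean_le {f : G → ℝ} {c : ℝ} (h : ∀ g, |f g| ≤ c) : |cellMean G N f| ≤ c := by
  rw [abs_le]
  constructor
  · exact (cellMean_const (G := G) (N := N) (-c)).symm.le.trans
      (cellMean_mono fun g => (abs_le.1 (h g)).1)
  · exact (cellMean_mono fun g => (abs_le.1 (h g)).2).trans (cellMean_const c).le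

theorem abs_cellMean_le_cellMean_abs (f : G → ℝ) :
    |cellMean G N f| ≤ cellMean G N fun g => |f g| :=
  abs_le.2 ⟨by rw [← cellMean_neg]; exact cellMean_mono fun g => neg_abs_le _,
    cellMean_mono fun g => le_abs_self _⟩

theorem eq_zero_of_cellMean_eq_zero {f : G → ℝ} (hp : IsPeriodicWith G N f) (h : ∀ g, 0 ≤ f g)
    (h0 : cellMean G N f ≤ 0) (g : G) : f g = 0 := by
  have := Fintype.ofFinite (G ⧸ transPow G N)
  have h1 := le_antisymm h0 (cellMean_nonneg h)
  rw [cellMean, finsum_eq_sum_of_fintype, mul_eq_zero_iff_left (by simp),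
    Finset.sum_eq_zero_iff_of_nonneg fun _ _ => h _] at h1
  rw [← hp.apply_out]
  exact h1 _ (Finset.mem_univ _)

/-- The Cauchy–Schwarz inequality for mean values. -/
theorem cellMean_mul_le (f f' : G → ℝ) : cellMean G N (fun g => f g * f' g) ≤
    √(cellMean G N fun g => f g ^ 2) * √(cellMean G N fun g => f' g ^ 2) := by
  have := Fintype.ofFinite (G ⧸ transPow G N)
  simp only [cellMean, finsum_eq_sum_of_fintype]
  rw [Real.sqrt_mul (by positivity), Real.sqrt_mul (by positivity), mul_mul_mul_comm,
    Real.mul_self_sqrt (by positivity)]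
  gcongr
  exact Real.sum_mul_le_sqrt_mul_sqrt _ _ _

end

theorem cellMean_shift {f : G → ℝ} (hf : IsPeriodicWith G N f) (k : G) :
    cellMean G N (fun g => f (g * k)) = cellMean G N f := by
  unfold cellMean
  congr 1
  rw [← finsum_comp_equiv (Equiv.mulRight (QuotientGroup.mk k : G ⧸ transPow G N))
    (f := fun q => f q.out)]
  refine finsum_congr fun q => ?_
  obtain ⟨g, rfl⟩ := QuotientGroup.mk_surjective q
  exact ((hf.shift k).apply_out g).trans (hf.apply_out (g * k)).symm

/-- `G / T^{NM}` is in bijection with `(G / T^N) × (T^N / T^{NM})`, and `f` depends on the first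
factor only; the cardinality of the second cancels in the normalization. -/
theorem cellMean_mul_period (hfin : Finite (G ⧸ transPow G (N * M))) {f : G → ℝ}
    (hf : IsPeriodicWith G N f) : cellMean G (N * M) f = cellMean G N f := by
  let e := Subgroup.quotientEquivProdOfLE (transPow_mul_le (G := G) N M)
  have he : ∀ g : G, (e (QuotientGroup.mk g)).1 = QuotientGroup.mk g := fun g => rfl
  have := Finite.of_equiv _ e
  have h1 : Finite (G ⧸ transPow G N) := Finite.prod_left (transPow G N ⧸
    (transPow G (N * M)).subgroupOf (transPow G N))
  have h2 : Finite (transPow G N ⧸ (transPow G (N * M)).subgroupOf (transPow G N)) :=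
    Finite.prod_right (G ⧸ transPow G N)
  have := Fintype.ofFinite (G ⧸ transPow G N)
  have := Fintype.ofFinite (transPow G N ⧸ (transPow G (N * M)).subgroupOf (transPow G N))
  have hsum : ∑ᶠ q : G ⧸ transPow G (N * M), f q.out =
      ∑ᶠ p : (G ⧸ transPow G N) × (transPow G N ⧸ (transPow G (N * M)).subgroupOf (transPow G N)),
        f p.1.out := by
    rw [← finsum_comp_equiv e]
    refine finsum_congr fun q => ?_
    obtain ⟨g, rfl⟩ := QuotientGroup.mk_surjective q
    rw [(hf.mul_right G M).apply_out, he, hf.apply_out]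
  rw [cellMean, hsum, cellMean, Nat.card_congr e, Nat.card_prod, finsum_eq_sum_of_fintype,
    Fintype.sum_prod_type, finsum_eq_sum_of_fintype]
  simp only [Finset.sum_const, Finset.card_univ, nsmul_eq_mul, ← Finset.mul_sum,
    Nat.card_eq_fintype_card, Nat.cast_mul]
  have : (Fintype.card (transPow G N ⧸ (transPow G (N * M)).subgroupOf (transPow G N)) : ℝ) ≠ 0 :=
    Nat.cast_ne_zero.2 Fintype.card_ne_zero
  field_simp

/-- The period inside `mean` is an arbitrary choice; it is compared with `N` through the product of
the two. -/
theorem mean_eq_cellMean (hfin : ∀ N, 0 < N → Finite (G ⧸ transPow G N)) (hN : 0 < N) {f : G → ℝ}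
    (hf : IsPeriodicWith G N f) : mean G f = cellMean G N f := by
  have h : IsPeriodic G f := ⟨N, hN, hf⟩
  obtain ⟨hpos, hper⟩ := h.choose_spec
  rw [mean, dif_pos h, ← cellMean_mul_period (hfin _ (Nat.mul_pos hpos hN)) hper,
    mul_comm, cellMean_mul_period (hfin _ (Nat.mul_pos hN hpos)) hf]

end Mean

/-! ### Superposition operators on spaces of bounded families -/

section Superposition

section Continuous

variable {ι F F' : Type*} [NormedAddCommGroup F] [ProperSpace F] [NormedAddCommGroup F']

theorem memℓp_infty_comp {W : F → F'} (hW : Continuous W) (u : lp (fun _ : ι => F) ∞) :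
    Memℓp (fun i => W (u i)) ∞ := by
  obtain ⟨C, hC⟩ := ((isCompact_closedBall (0 : F) ‖u‖).image hW).isBounded.exists_norm_le
  refine memℓp_infty ⟨C, ?_⟩
  rintro _ ⟨i, rfl⟩
  refine hC _ ⟨u i, ?_, rfl⟩
  simpa using lp.norm_apply_le_norm ENNReal.top_ne_zero u i

/-- A continuous function on a proper space is uniformly continuous near a bounded family. -/
theorem exists_forall_dist_lt_of_lp {W : F → F'} (hW : Continuous W) (u : lp (fun _ : ι => F) ∞)
    {ε : ℝ} (hε : 0 < ε) : ∃ δ > 0, ∀ i x, dist x (u i) < δ → dist (W x) (W (u i)) < ε := by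
  have huc := (isCompact_closedBall (0 : F) (‖u‖ + 1)).uniformContinuousOn_of_continuous
    hW.continuousOn
  obtain ⟨δ, hδ, h⟩ := Metric.uniformContinuousOn_iff.1 huc ε hε
  refine ⟨min δ 1, by positivity, fun i x hx => ?_⟩
  have hu := lp.norm_apply_le_norm ENNReal.top_ne_zero u i
  have hx' : ‖x - u i‖ < min δ 1 := by rwa [← dist_eq_norm]
  refine h x ?_ (u i) ?_ (hx.trans_le (min_le_left _ _))
  · rw [mem_closedBall_zero_iff]
    have := norm_le_norm_add_norm_sub' x (u i)
    have := hx'.trans_le (min_le_right δ 1)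
    linarith
  · rw [mem_closedBall_zero_iff]
    linarith

/-- The superposition operator `u ↦ W ∘ u` on the bounded families. -/
noncomputable def lpComp (W : F → F') (hW : Continuous W) (u : lp (fun _ : ι => F) ∞) :
    lp (fun _ : ι => F') ∞ :=
  ⟨fun i => W (u i), memℓp_infty_comp hW u⟩

theorem continuous_lpComp {W : F → F'} (hW : Continuous W) :
    Continuous (lpComp (ι := ι) W hW) := by
  rw [Metric.continuous_iff]
  intro u ε hε
  obtain ⟨δ, hδ, h⟩ := exists_forall_dist_lt_of_lp hW u (half_pos hε)
  refine ⟨δ, hδ, fun v hv => ?_⟩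
  rw [dist_eq_norm] at hv ⊢
  refine (lp.norm_le_of_forall_le (half_pos hε).le fun i => ?_).trans_lt (half_lt_self hε)
  have h1 := h i (v i) (by
    rw [dist_eq_norm]
    exact (lp.norm_apply_le_norm ENNReal.top_ne_zero (v - u) i).trans_lt hv)
  rw [dist_eq_norm] at h1
  exact h1.le

end Continuous

variable {ι : Type*} {F F' : Type} [NormedAddCommGroup F] [NormedSpace ℝ F]
  [NormedAddCommGroup F'] [NormedSpace ℝ F']

/-- The pointwise application of a bounded family of operators to a bounded family of vectors. -/
noncomputable def lpApply : lp (fun _ : ι => F →L[ℝ] F') ∞ →L[ℝ] lp (fun _ : ι => F) ∞ →L[ℝ]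
    lp (fun _ : ι => F') ∞ :=
  have key : ∀ (T : lp (fun _ : ι => F →L[ℝ] F') ∞) (u : lp (fun _ : ι => F) ∞) (i : ι),
      ‖T i (u i)‖ ≤ ‖T‖ * ‖u‖ := fun T u i =>
    (T i).le_of_opNorm_le_of_le (lp.norm_apply_le_norm ENNReal.top_ne_zero T i)
      (lp.norm_apply_le_norm ENNReal.top_ne_zero u i)
  LinearMap.mkContinuous₂
    (LinearMap.mk₂ ℝ (fun T u => ⟨fun i => T i (u i),
        memℓp_infty ⟨‖T‖ * ‖u‖, by rintro _ ⟨i, rfl⟩; exact key T u i⟩⟩)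
      (fun T T' u => by ext i; rfl)
      (fun c T u => by ext i; rfl)
      (fun T u u' => by ext i : 2; exact map_add _ _ _)
      (fun c T u => by ext i : 2; exact map_smul _ _ _))
    1 fun T u => by
      rw [one_mul]
      exact lp.norm_le_of_forall_le (by positivity) (key T u)

/-- A uniformly bounded family of operators as an operator into the bounded families. -/
noncomputable def lpPi (A : ι → F →L[ℝ] F') (C : ℝ) (hA : ∀ i, ‖A i‖ ≤ C) :
    F →L[ℝ] lp (fun _ : ι => F') ∞ :=
  have key : ∀ x i, ‖A i x‖ ≤ |C| * ‖x‖ := fun x i =>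
    (A i).le_of_opNorm_le ((hA i).trans (le_abs_self C)) x
  LinearMap.mkContinuous
    { toFun := fun x => ⟨fun i => A i x,
        memℓp_infty ⟨|C| * ‖x‖, by rintro _ ⟨i, rfl⟩; exact key x i⟩⟩
      map_add' := fun x y => by ext i : 2; exact map_add _ _ _
      map_smul' := fun c x => by ext i : 2; exact map_smul _ _ _ }
    |C| fun x => lp.norm_le_of_forall_le (by positivity) (key x)

variable [ProperSpace F]

/-- The mean value inequality is applied to `W` in each coordinate. The radius `δ` is the same for
all coordinates, since `fderiv ℝ W` is uniformly continuous on bounded sets of the proper space `F`.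
-/
theorem hasFDerivAt_lpComp {W : F → F'} (hW : Differentiable ℝ W) (hW' : Continuous (fderiv ℝ W))
    (u : lp (fun _ : ι => F) ∞) :
    HasFDerivAt (lpComp (ι := ι) W hW.continuous) (lpApply (lpComp (fderiv ℝ W) hW' u)) u := by
  rw [hasFDerivAt_iff_isLittleO_nhds_zero, Asymptotics.isLittleO_iff]
  intro c hc
  obtain ⟨δ, hδ, h⟩ := exists_forall_dist_lt_of_lp hW' u hc
  filter_upwards [Metric.ball_mem_nhds 0 hδ] with v hv
  rw [mem_ball_zero_iff] at hv
  refine lp.norm_le_of_forall_le (by positivity) fun i => ?_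
  have hvi := lp.norm_apply_le_norm ENNReal.top_ne_zero v i
  have key := Convex.norm_image_sub_le_of_norm_fderiv_le' (𝕜 := ℝ) (f := W)
    (φ := fderiv ℝ W (u i)) (C := c) (s := Metric.ball (u i) δ) (x := u i) (y := u i + v i)
    (fun x _ => hW x) (fun x hx => by
      rw [← dist_eq_norm]
      exact (h i x hx).le)
    (convex_ball _ _) (Metric.mem_ball_self hδ) (by
      rw [Metric.mem_ball, dist_self_add_left]
      exact hvi.trans_lt hv)
  rw [add_sub_cancel_left] at key
  exact key.trans (by gcongr)

/-- The derivative is again a superposition operator, that of `fderiv ℝ W`, followed by the bounded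
linear map `lpApply`. The induction changes the codomain to `F →L[ℝ] F'`, hence the generalization
over `F'` and the common universe of `F` and `F'`. -/
theorem contDiff_lpComp (n : ℕ) {F' : Type} [NormedAddCommGroup F'] [NormedSpace ℝ F']
    {W : F → F'} (hW : ContDiff ℝ n W) : ContDiff ℝ n (lpComp (ι := ι) W hW.continuous) := by
  induction n generalizing F' with
  | zero => exact contDiff_zero.2 (continuous_lpComp _)
  | succ n ih =>
    have hW2 := hW
    push_cast at hW2 ⊢
    have h' : ContDiff ℝ n (fderiv ℝ W) := (contDiff_succ_iff_fderiv.1 hW2).2.2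
    rw [contDiff_succ_iff_hasFDerivAt]
    exact ⟨fun u => lpApply (lpComp (fderiv ℝ W) h'.continuous u),
      (lpApply (ι := ι) (F := F) (F' := F')).contDiff.comp (ih h'),
      hasFDerivAt_lpComp (contDiff_succ_iff_fderiv.1 hW2).1 h'.continuous⟩

/-- The inner map is affine and the outer one linear, so two uses of the chain rule leave only the
term with the second derivative of `W`. -/
theorem fderiv_fderiv_lpComp {X Y : Type*} [NormedAddCommGroup X] [NormedSpace ℝ X]
    [NormedAddCommGroup Y] [NormedSpace ℝ Y] {W : F → F'} (hW : ContDiff ℝ 2 W)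
    (hW'' : Continuous (fderiv ℝ (fderiv ℝ W)))
    (M : lp (fun _ : ι => F') ∞ →L[ℝ] Y) (A : X →L[ℝ] lp (fun _ : ι => F) ∞)
    (y : lp (fun _ : ι => F) ∞) (w u v : X) :
    fderiv ℝ (fderiv ℝ fun w => M (lpComp W hW.continuous (A w + y))) w u v =
      M (lpApply (lpApply (lpComp _ hW'' (A w + y)) (A u)) (A v)) := by
  have h1 : ContDiff ℝ 1 (fderiv ℝ W) := hW.fderiv_right (by norm_num)
  have hA : ∀ w, HasFDerivAt (fun w => A w + y) A w := fun w => A.hasFDerivAt.add_const y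
  have e1 : (fderiv ℝ fun w => M (lpComp W hW.continuous (A w + y))) = fun w =>
      M.comp ((lpApply (lpComp (fderiv ℝ W) h1.continuous (A w + y))).comp A) := by
    ext1 w
    exact (M.hasFDerivAt.comp w ((hasFDerivAt_lpComp (hW.differentiable (by norm_num))
      h1.continuous (A w + y)).comp w (hA w))).fderiv
  have h2 : HasFDerivAt (lpComp (ι := ι) (fderiv ℝ W) h1.continuous)
      (lpApply (lpComp _ hW'' (A w + y))) (A w + y) :=
    hasFDerivAt_lpComp (h1.differentiable (by norm_num)) hW'' (A w + y)
  have h2A := h2.comp w (hA w)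
  have h2' : HasFDerivAt (fun w => lpApply (lpComp (fderiv ℝ W) h1.continuous (A w + y)))
      (lpApply.comp ((lpApply (lpComp _ hW'' (A w + y))).comp A)) w :=
    (lpApply (ι := ι) (F := F) (F' := F')).hasFDerivAt.comp w h2A
  rw [e1]
  have h3 := ((ContinuousLinearMap.compL ℝ X _ Y M).hasFDerivAt.comp w
    (((ContinuousLinearMap.compL ℝ X _ _).flip A).hasFDerivAt.comp w h2')).fderiv
  exact congrArg (fun T : X →L[ℝ] X →L[ℝ] Y => T u v) h3

end Superposition

/-! ### Regularity of the energy -/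

section EnergyRegularity

variable {d : ℕ} {G : Subgroup (EucGroup d)}

/-- The mean value of periodic functions extends to a bounded functional on `L^∞(G)`. -/
theorem exists_mean_functional (hfin : ∀ N, 0 < N → Finite (G ⧸ transPow G N)) :
    ∃ M : lp (fun _ : G => ℝ) ∞ →L[ℝ] ℝ, ∀ N, 0 < N → ∀ f : lp (fun _ : G => ℝ) ∞,
      IsPeriodicWith G N f → M f = cellMean G N f := by
  let p : Submodule ℝ (lp (fun _ : G => ℝ) ∞) :=
    { carrier := {f | IsPeriodic G f}
      zero_mem' := ⟨1, one_pos, fun _ _ _ => rfl⟩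
      add_mem' := by
        rintro f f' ⟨N, hN, hf⟩ ⟨M, hM, hf'⟩
        exact ⟨N * M, Nat.mul_pos hN hM, (hf.mul_right G M).comp₂ (hf'.mul_left N) (· + ·)⟩
      smul_mem' := by
        rintro c f ⟨N, hN, hf⟩
        exact ⟨N, hN, hf.comp (c • ·)⟩ }
  let φ : p →ₗ[ℝ] ℝ :=
    { toFun := fun f => mean G f.1
      map_add' := by
        rintro ⟨f, N, hN, hf⟩ ⟨f', M, hM, hf'⟩
        have hNM := Nat.mul_pos hN hM
        have := hfin _ hNM
        have h1 := hf.mul_right G M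
        have h2 := hf'.mul_left N
        change mean G (fun g => f g + f' g) = mean G f + mean G f'
        rw [mean_eq_cellMean hfin hNM h1, mean_eq_cellMean hfin hNM h2,
          mean_eq_cellMean hfin hNM (h1.comp₂ h2 (· + ·)), cellMean_add]
      map_smul' := by
        rintro c ⟨f, N, hN, hf⟩
        have := hfin _ hN
        change mean G (fun g => c * f g) = c * mean G f
        rw [mean_eq_cellMean hfin hN hf, mean_eq_cellMean hfin hN (hf.comp (c * ·)),
          cellMean_const_mul] }
  have hφ : ∀ f, ‖φ f‖ ≤ 1 * ‖f‖ := by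
    rintro ⟨f, N, hN, hf⟩
    have := hfin _ hN
    change |mean G f| ≤ 1 * ‖f‖
    rw [mean_eq_cellMean hfin hN hf, one_mul]
    exact abs_cellMean_le fun g => lp.norm_apply_le_norm ENNReal.top_ne_zero f g
  -- Hahn–Banach: with the mean extended, superposition operators may take values in all of `L^∞`.
  -- Only the values of `M` at periodic functions are used later.
  obtain ⟨M, hM, -⟩ := _root_.exists_extension_norm_eq p (φ.mkContinuous 1 hφ)
  refine ⟨M, fun N hN f hf => ?_⟩
  exact (hM ⟨f, N, hN, hf⟩).trans (mean_eq_cellMean hfin hN hf)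

/-- The discrete derivative `u ↦ rot(h) u(gh) - u(g)`. -/
noncomputable def diffCLM (h g : G) : Uper G →L[ℝ] Pt d :=
  ((rot (h : EucGroup d)).toContinuousLinearEquiv.toContinuousLinearMap ∘L
    lp.evalCLM ℝ (fun _ : G => Pt d) ∞ (g * h) -
    lp.evalCLM ℝ (fun _ : G => Pt d) ∞ g) ∘L (Uper G).subtypeL

theorem diffCLM_apply (h g : G) (u : Uper G) :
    diffCLM h g u = rot (h : EucGroup d) (u.val (g * h)) - u.val g := rfl

theorem norm_diffCLM_le (h g : G) : ‖diffCLM h g‖ ≤ 2 := by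
  refine ContinuousLinearMap.opNorm_le_bound _ zero_le_two fun u => ?_
  rw [diffCLM_apply]
  refine (norm_sub_le _ _).trans ?_
  rw [LinearIsometryEquiv.norm_map, two_mul]
  exact add_le_add (lp.norm_apply_le_norm ENNReal.top_ne_zero (u : lp (fun _ : G => Pt d) ∞) _)
    (lp.norm_apply_le_norm ENNReal.top_ne_zero (u : lp (fun _ : G => Pt d) ∞) _)

theorem isPeriodicWith_diffCLM {N : ℕ} {u : Uper G} (hu : IsPeriodicWith G N u.val) (h : G) :
    IsPeriodicWith G N fun g => diffCLM h g u :=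
  (hu.shift h).comp₂ hu fun x y => rot (h : EucGroup d) x - y

/-- By invariance under `O(d)`, the site potential is a function of `h ↦ h · w(gh) - w(g)`. -/
theorem site_potential_eq {V : (NonId G → Pt d) → ℝ} (hV : IsOrthInvariant V) (w : G → Pt d)
    (g : G) :
    (V fun h : NonId G => ((g * (h : G) : G) : EucGroup d) (w (g * h)) - (g : EucGroup d) (w g)) =
      V fun h : NonId G => ((h : G) : EucGroup d) (w (g * h)) - w g := by
  rw [← hV (rot (g : EucGroup d)) fun h : NonId G => ((h : G) : EucGroup d) (w (g * h)) - w g]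
  congr 1
  ext1 h
  rw [coe_mul_apply, apply_sub_apply]

open Classical in
/-- The extension of a finite family by zero. -/
noncomputable def zeroExtend {ι E : Type*} [NormedAddCommGroup E] [NormedSpace ℝ E] (s : Set ι)
    [Fintype s] : (s → E) →ₗ[ℝ] lp (fun _ : ι => E) ∞ where
  toFun x := ⟨fun h => if hh : h ∈ s then x ⟨h, hh⟩ else 0, memℓp_infty ⟨‖x‖, by
    rintro _ ⟨h, rfl⟩
    beta_reduce
    split_ifs with hh
    · exact norm_le_pi_norm x _
    · simp⟩⟩
  map_add' x y := by
    ext h : 2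
    change (if hh : h ∈ s then x ⟨h, hh⟩ + y ⟨h, hh⟩ else 0) =
      (if hh : h ∈ s then x ⟨h, hh⟩ else 0) + (if hh : h ∈ s then y ⟨h, hh⟩ else 0)
    split_ifs <;> simp
  map_smul' c x := by
    ext h : 2
    by_cases hh : h ∈ s
    · simp [hh]
    · simp [hh]

open Classical in
theorem zeroExtend_apply {ι E : Type*} [NormedAddCommGroup E] [NormedSpace ℝ E] (s : Set ι)
    [Fintype s] (x : s → E) (i : ι) :
    zeroExtend s x i = if h : i ∈ s then x ⟨i, h⟩ else 0 := rfl

/-- A smooth potential of finite range is a smooth function of finitely many variables. -/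
theorem exists_finite_dimensional_potential {V : (NonId G → Pt d) → ℝ}
    (hV_smooth : IsSmoothPotential V) (s : Set (NonId G)) [Fintype s]
    (hs : ∀ y, V y = V (s.indicator y)) :
    ∃ W : (s → Pt d) → ℝ, ContDiff ℝ 2 W ∧ ∀ y, V y = W fun h => y h := by
  classical
  -- The summand `0` matches the form `y + z` in the smoothness hypothesis, used at `y = 0`.
  refine ⟨fun x => V fun h => 0 + zeroExtend s x h,
    (hV_smooth fun _ => 0).comp (LinearMap.toContinuousLinearMap (zeroExtend (E := Pt d) s)).contDiff,
    fun y => ?_⟩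
  rw [hs]
  congr 1
  ext1 h
  rw [zeroExtend_apply, zero_add, Set.indicator_apply]
  split_ifs <;> rfl

/-- The discrete derivatives at `g` in the directions of `s`. -/
noncomputable def diffPi (s : Set (NonId G)) [Fintype s] (g : G) : Uper G →L[ℝ] s → Pt d :=
  ContinuousLinearMap.pi fun h : s => diffCLM (h : NonId G) g

theorem diffPi_apply (s : Set (NonId G)) [Fintype s] (g : G) (u : Uper G) (h : s) :
    diffPi s g u h = diffCLM (h : NonId G) g u := rfl

theorem norm_diffPi_le (s : Set (NonId G)) [Fintype s] (g : G) : ‖diffPi s g‖ ≤ 2 := by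
  refine ContinuousLinearMap.opNorm_le_bound _ zero_le_two fun u => ?_
  refine (pi_norm_le_iff_of_nonneg (by positivity)).2 fun h => ?_
  rw [diffPi_apply]
  exact ContinuousLinearMap.le_of_opNorm_le _ (norm_diffCLM_le _ _) u

open Classical in
theorem norm_diffPi_apply_le (s : Set (NonId G)) [Fintype s] (g : G) (u : Uper G) :
    ‖diffPi s g u‖ ≤ √(∑ h ∈ s.toFinset.image Subtype.val, ‖diffCLM h g u‖ ^ 2) := by
  refine (pi_norm_le_iff_of_nonneg (by positivity)).2 fun h => ?_
  refine Real.le_sqrt_of_sq_le ?_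
  exact Finset.single_le_sum (f := fun h => ‖diffCLM h g u‖ ^ 2) (fun _ _ => by positivity)
    (Finset.mem_image_of_mem Subtype.val (Set.mem_toFinset.2 h.2))

theorem isPeriodicWith_diffPi (s : Set (NonId G)) [Fintype s] {N : ℕ} {u : Uper G}
    (hu : IsPeriodicWith G N u.val) : IsPeriodicWith G N fun g => diffPi s g u :=
  IsPeriodicWith.pi fun _ => isPeriodicWith_diffCLM hu _

/-- The family of all discrete derivatives in the directions of `s`. -/
noncomputable def diffLp (s : Set (NonId G)) [Fintype s] :
    Uper G →L[ℝ] lp (fun _ : G => s → Pt d) ∞ :=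
  lpPi (diffPi s) 2 (norm_diffPi_le s)

/-- The constant family `g ↦ z`. -/
def lpConst (ι : Type*) {F : Type*} [NormedAddCommGroup F] (z : F) : lp (fun _ : ι => F) ∞ :=
  ⟨fun _ => z, memℓp_infty ⟨‖z‖, by rintro _ ⟨_, rfl⟩; exact le_rfl⟩⟩

/-- Splitting `h · x = rot(h) x + h · 0` makes the arguments of `W` affine in `w`, with linear part
the discrete derivatives. -/
theorem energy_eq_functional {V : (NonId G → Pt d) → ℝ} (hV_inv : IsOrthInvariant V)
    (hfin : ∀ N, 0 < N → Finite (G ⧸ transPow G N)) (s : Set (NonId G)) [Fintype s]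
    {W : (s → Pt d) → ℝ} (hW : Continuous W) (hVW : ∀ y, V y = W fun h => y h)
    {M : lp (fun _ : G => ℝ) ∞ →L[ℝ] ℝ}
    (hM : ∀ N, 0 < N → ∀ f : lp (fun _ : G => ℝ) ∞, IsPeriodicWith G N f → M f = cellMean G N f)
    (w : Uper G) :
    energy V w = M (lpComp W hW (diffLp s w + lpConst G fun h : s => ((h : NonId G) : G).1 0)) := by
  set z : s → Pt d := fun h => ((h : NonId G) : G).1 0 with hz
  obtain ⟨N, hN, hw⟩ := w.2
  have hp : IsPeriodicWith G N fun g => W (diffPi s g w + z) :=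
    (isPeriodicWith_diffPi s hw).comp fun x => W (x + z)
  refine Eq.trans ?_ ((mean_eq_cellMean hfin hN hp).trans (hM N hN (lpComp W hW (diffLp s w + lpConst G z)) hp).symm)
  unfold energy
  congr 1
  ext1 g
  rw [site_potential_eq hV_inv, hVW]
  congr 1
  ext1 h
  rw [apply_eq_rot_add, Pi.add_apply, diffPi_apply, diffCLM_apply, hz]
  abel

-- Periodicity of `Q`, `u` and `v` makes the integrand periodic, so that `M` is an actual cell mean
-- and the pointwise operator bound can be averaged.
open Classical in
theorem abs_functional_lpApply_le (hfin : ∀ N, 0 < N → Finite (G ⧸ transPow G N))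
    (s : Set (NonId G)) [Fintype s] {M : lp (fun _ : G => ℝ) ∞ →L[ℝ] ℝ}
    (hM : ∀ N, 0 < N → ∀ f : lp (fun _ : G => ℝ) ∞, IsPeriodicWith G N f → M f = cellMean G N f)
    (Q : lp (fun _ : G => (s → Pt d) →L[ℝ] (s → Pt d) →L[ℝ] ℝ) ∞) {N : ℕ} (hN : 0 < N)
    (hQ : IsPeriodicWith G N Q) {u v : Uper G} (hu : IsPeriodicWith G N u.val)
    (hv : IsPeriodicWith G N v.val) :
    |M (lpApply (lpApply Q (diffLp s u)) (diffLp s v))| ≤ ‖Q‖ * cellMean G N fun g =>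
      √(∑ h ∈ s.toFinset.image Subtype.val, ‖diffCLM h g u‖ ^ 2) *
        √(∑ h ∈ s.toFinset.image Subtype.val, ‖diffCLM h g v‖ ^ 2) := by
  have := hfin N hN
  have hp : IsPeriodicWith G N fun g => Q g (diffPi s g u) (diffPi s g v) :=
    (hQ.comp₂ (isPeriodicWith_diffPi s hu) fun T x => T x).comp₂
      (isPeriodicWith_diffPi s hv) fun T x => T x
  rw [hM N hN (lpApply (lpApply Q (diffLp s u)) (diffLp s v)) hp, ← cellMean_const_mul]
  refine (abs_cellMean_le_cellMean_abs _).trans (cellMean_mono fun g => ?_)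
  change ‖Q g (diffPi s g u) (diffPi s g v)‖ ≤ _
  refine ((Q g).le_opNorm₂ _ _).trans ?_
  rw [mul_assoc]
  exact mul_le_mul (lp.norm_apply_le_norm ENNReal.top_ne_zero Q g)
    (mul_le_mul (norm_diffPi_apply_le s g u) (norm_diffPi_apply_le s g v) (norm_nonneg _)
      (Real.sqrt_nonneg _)) (by positivity) (norm_nonneg _)

set_option maxHeartbeats 1000000 in
/-- The energy is twice continuously differentiable, and its second derivative at a constant
function is controlled by finitely many discrete derivatives. -/
theorem energy_regular (hfin : ∀ N, 0 < N → Finite (G ⧸ transPow G N))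
    {V : (NonId G → Pt d) → ℝ} (hV_inv : IsOrthInvariant V) (hV_smooth : IsSmoothPotential V)
    (hV_range : HasFiniteRange V) (x₀ : Pt d) :
    ContDiff ℝ 2 (energy V) ∧ ∃ s : Finset G, ∃ C : ℝ, 0 ≤ C ∧
      ∀ N, 0 < N → ∀ u v : Uper G, IsPeriodicWith G N u.val → IsPeriodicWith G N v.val →
        |energyHess V x₀ u v| ≤ C * cellMean G N fun g =>
          √(∑ h ∈ s, ‖diffCLM h g u‖ ^ 2) * √(∑ h ∈ s, ‖diffCLM h g v‖ ^ 2) := by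
  classical
  obtain ⟨s, hsfin, hs⟩ := hV_range
  have : Fintype s := hsfin.fintype
  obtain ⟨M, hM⟩ := exists_mean_functional hfin
  obtain ⟨W, hW, hVW⟩ := exists_finite_dimensional_potential hV_smooth s hs
  have hW1 : ContDiff ℝ 1 (fderiv ℝ W) := hW.fderiv_right (by norm_num)
  have hW2 : Continuous (fderiv ℝ (fderiv ℝ W)) := hW1.continuous_fderiv (by norm_num)
  obtain ⟨z, hE⟩ : ∃ z, energy V = fun w => M (lpComp W hW.continuous (diffLp s w + lpConst G z)) :=
    ⟨_, funext (energy_eq_functional hV_inv hfin s hW.continuous hVW hM)⟩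
  constructor
  · rw [hE]
    exact M.contDiff.comp ((contDiff_lpComp 2 hW).comp ((diffLp s).contDiff.add contDiff_const))
  -- The constant is the supremum over `g` of the norm of the second derivative of `W` along the
  -- identity deformation.
  · refine ⟨s.toFinset.image Subtype.val, _, norm_nonneg
      (lpComp (fderiv ℝ (fderiv ℝ W)) hW2 (diffLp s (constU G x₀) + lpConst G z)), fun N hN u v hu hv => ?_⟩
    rw [energyHess, hE, fderiv_fderiv_lpComp hW hW2]
    refine abs_functional_lpApply_le hfin s hM _ hN ?_ hu hv
    -- The constant deformation is `T^N`-periodic for every `N`, in particular for the common period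
    -- of `u` and `v`.
    exact (isPeriodicWith_diffPi s (u := constU G x₀) fun _ _ _ => rfl).comp
      fun x => fderiv ℝ (fderiv ℝ W) (x + z)

end EnergyRegularity

/-! ### A discrete Korn inequality -/

section Korn

variable {d : ℕ} {G : Subgroup (EucGroup d)}

/-- Summation by parts for commuting difference operators. -/
theorem cellMean_diff_mul_diff {N : ℕ} [Finite (G ⧸ transPow G N)] {p q : G → ℝ}
    (hp : IsPeriodicWith G N p) (hq : IsPeriodicWith G N q) {s t : G} (hst : Commute s t) :
    cellMean G N (fun g => (p (g * s) - p g) * (q (g * t) - q g)) =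
      cellMean G N (fun g => (p (g * t⁻¹) - p g) * (q (g * s⁻¹) - q g)) := by
  -- Of the products in the expansion, only this one needs commutation: after the shift by `s⁻¹
  -- t⁻¹`, the argument `g s⁻¹ t⁻¹ s` has to be `g t⁻¹`.
  have e1 : cellMean G N (fun g => p (g * s) * q (g * t)) =
      cellMean G N (fun g => p (g * t⁻¹) * q (g * s⁻¹)) := by
    rw [← cellMean_shift ((hp.shift s).comp₂ (hq.shift t) (· * ·)) (s⁻¹ * t⁻¹)]
    congr 1
    ext1 g
    have h1 : g * (s⁻¹ * t⁻¹) * s = g * t⁻¹ := by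
      rw [mul_assoc, (hst.symm.inv_left.eq ▸ mul_assoc s⁻¹ t⁻¹ s : s⁻¹ * t⁻¹ * s = s⁻¹ * (s * t⁻¹)),
        inv_mul_cancel_left]
    have h2 : g * (s⁻¹ * t⁻¹) * t = g * s⁻¹ := by group
    simp only [h1, h2]
  have e2 : cellMean G N (fun g => p (g * s) * q g) = cellMean G N (fun g => p g * q (g * s⁻¹)) := by
    rw [← cellMean_shift ((hp.shift s).comp₂ hq (· * ·)) s⁻¹]
    simp only [inv_mul_cancel_right]
  have e3 : cellMean G N (fun g => p g * q (g * t)) = cellMean G N (fun g => p (g * t⁻¹) * q g) := by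
    rw [← cellMean_shift (hp.comp₂ (hq.shift t) (· * ·)) t⁻¹]
    simp only [inv_mul_cancel_right]
  have expand : ∀ a b a' b' : G → ℝ, cellMean G N (fun g => (a g - b g) * (a' g - b' g)) =
      cellMean G N (fun g => a g * a' g) - cellMean G N (fun g => a g * b' g) -
      cellMean G N (fun g => b g * a' g) + cellMean G N (fun g => b g * b' g) := by
    intro a b a' b'
    rw [← cellMean_sub, ← cellMean_sub, ← cellMean_add]
    congr 1
    ext1 g
    ring
  rw [expand, expand, e1, e2, e3]
  ring

/-- The nonnegativity of the mean of `∑ᵢⱼ (∂ᵢ Uⱼ) (∂ⱼ Uᵢ)`, which is the mean of the squared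
divergence. -/
theorem sum_cellMean_diff_mul_diff_nonneg {N : ℕ} [Finite (G ⧸ transPow G N)] {ι : Type*}
    [Fintype ι] {U : ι → G → ℝ} (hU : ∀ i, IsPeriodicWith G N (U i)) {t : ι → G}
    (ht : ∀ i j, Commute (t i) (t j)) :
    0 ≤ ∑ i, ∑ j, cellMean G N
      fun g => (U j (g * t i) - U j g) * (U i (g * t j) - U i g) := by
  -- Summation by parts pairs `U j` with `t j` and `U i` with `t i`; the double sum then factors
  -- into the square of the backward divergence.
  have h : ∀ i j, cellMean G N (fun g => (U j (g * t i) - U j g) * (U i (g * t j) - U i g)) =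
      cellMean G N (fun g => (U j (g * (t j)⁻¹) - U j g) * (U i (g * (t i)⁻¹) - U i g)) :=
    fun i j => cellMean_diff_mul_diff (hU j) (hU i) (ht i j)
  simp only [h, ← cellMean_sum]
  refine cellMean_nonneg fun g => ?_
  simp only [← Finset.sum_mul]
  rw [← Finset.mul_sum]
  exact mul_self_nonneg _

/-- The discrete Korn inequality for the differences along commuting directions. -/
theorem sum_cellMean_diff_sq_le {N : ℕ} [Finite (G ⧸ transPow G N)] {ι : Type*}
    [Fintype ι] {U : ι → G → ℝ} (hU : ∀ i, IsPeriodicWith G N (U i)) {t : ι → G}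
    (ht : ∀ i j, Commute (t i) (t j)) :
    ∑ i, ∑ j, cellMean G N (fun g => (U j (g * t i) - U j g) ^ 2) ≤
      ∑ i, ∑ j, cellMean G N
        fun g => ((U j (g * t i) - U j g) + (U i (g * t j) - U i g)) ^ 2 := by
  have h : ∀ i j, cellMean G N
      (fun g => ((U j (g * t i) - U j g) + (U i (g * t j) - U i g)) ^ 2) =
      cellMean G N (fun g => (U j (g * t i) - U j g) ^ 2) +
      cellMean G N (fun g => (U i (g * t j) - U i g) ^ 2) +
      2 * cellMean G N (fun g => (U j (g * t i) - U j g) * (U i (g * t j) - U i g)) := by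
    intro i j
    rw [← cellMean_const_mul, ← cellMean_add, ← cellMean_add]
    congr 1
    ext1 g
    ring
  simp only [h, Finset.sum_add_distrib, ← Finset.mul_sum]
  have h1 := sum_cellMean_diff_mul_diff_nonneg hU ht
  have h2 : 0 ≤ ∑ i, ∑ j, cellMean G N (fun g => (U i (g * t j) - U i g) ^ 2) :=
    Finset.sum_nonneg fun i _ => Finset.sum_nonneg fun j _ => cellMean_nonneg fun g => sq_nonneg _
  linarith

variable (x₀ : Pt d) (R : Finset G)

/-- The distance of `u(g ·)|_R` from the infinitesimally rigid displacements. -/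
noncomputable def defect (u : Uper G) (g : G) : ℝ :=
  ‖(Uiso (skew d) x₀ R)ᗮ.starProjection (localRestrict R u g)‖

/-- The quantity `f` depends periodically on periodic `u`, and its mean square is bounded by a
multiple of `‖u‖_R²`. -/
def Controlled {E : Type*} [NormedAddCommGroup E] (f : Uper G → G → E) : Prop :=
  (∀ N u, IsPeriodicWith G N (Uper.val u) → IsPeriodicWith G N (f u)) ∧
    ∃ C : ℝ, 0 ≤ C ∧ ∀ N, 0 < N → ∀ u : Uper G, IsPeriodicWith G N u.val →
      cellMean G N (fun g => ‖f u g‖ ^ 2) ≤ C * cellMean G N fun g => defect x₀ R u g ^ 2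

variable {x₀ R}

theorem isPeriodicWith_localRestrict {N : ℕ} {u : Uper G} (hu : IsPeriodicWith G N u.val) :
    IsPeriodicWith G N (localRestrict R u) :=
  (IsPeriodicWith.pi fun h : R => hu.shift (h : G)).comp (WithLp.toLp 2)

theorem isPeriodicWith_defect {N : ℕ} {u : Uper G} (hu : IsPeriodicWith G N u.val) :
    IsPeriodicWith G N (defect x₀ R u) :=
  (isPeriodicWith_localRestrict hu).comp fun v => ‖(Uiso (skew d) x₀ R)ᗮ.starProjection v‖

/-- For each local displacement there is a rigid one at the smallest possible distance. -/
theorem exists_rigid_fit (x₀ : Pt d) (R : Finset G) (v : LocalFun R) :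
    ∃ J : Pt d →ᵃ[ℝ] Pt d, (∀ x y, inner ℝ x (J.linear y) + inner ℝ y (J.linear x) = 0) ∧
      ∀ h : R, ‖rot ((h : G) : EucGroup d) (v h) - J (((h : G) : EucGroup d) x₀)‖ ≤
        ‖(Uiso (skew d) x₀ R)ᗮ.starProjection v‖ := by
  set K := Uiso (skew d) x₀ R
  obtain ⟨p, ⟨a, hp⟩, q, ⟨S, hS, hq⟩, hpq⟩ := Submodule.mem_sup.1 (K.starProjection_apply_mem v)
  -- The constant term is chosen so that the value at `h · x₀` is `a + S (h · x₀ - x₀)`, the rotated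
  -- value of the orthogonal projection onto the rigid displacements.
  refine ⟨(Matrix.toEuclideanLin S).toAffineMap +
    AffineMap.const ℝ (Pt d) (a - Matrix.toEuclideanLin S x₀), fun x y => ?_, fun h => ?_⟩
  · have hlin : ((Matrix.toEuclideanLin S).toAffineMap +
        AffineMap.const ℝ (Pt d) (a - Matrix.toEuclideanLin S x₀)).linear =
        Matrix.toEuclideanLin S := by
      ext x : 1
      simp
    rw [hlin]
    have hadj : LinearMap.adjoint (Matrix.toEuclideanLin S) = -Matrix.toEuclideanLin S := by
      rw [← Matrix.toEuclideanLin_conjTranspose_eq_adjoint, Matrix.conjTranspose_eq_transpose_of_trivial,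
        show S.transpose = -S from hS, map_neg]
    rw [← LinearMap.adjoint_inner_left, hadj, real_inner_comm, LinearMap.neg_apply, inner_neg_right]
    exact neg_add_cancel _
  · have hproj : (Kᗮ).starProjection v = v - K.starProjection v := by
      rw [Submodule.starProjection_orthogonal]
      rfl
    have hJ : ((Matrix.toEuclideanLin S).toAffineMap +
        AffineMap.const ℝ (Pt d) (a - Matrix.toEuclideanLin S x₀))
          (((h : G) : EucGroup d) x₀) = rot ((h : G) : EucGroup d) (K.starProjection v h) := by
      rw [← hpq, PiLp.add_apply, map_add, hp, hq, map_sub]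
      simp
      abel
    rw [hJ, ← map_sub, LinearIsometryEquiv.norm_map, hproj, ← PiLp.sub_apply]
    exact PiLp.norm_apply_le _ _

end Korn

/-! ### Quantities controlled by the seminorm, and rigid fits -/

section Controlled

variable {d : ℕ} {G : Subgroup (EucGroup d)} {x₀ : Pt d} {R : Finset G}
  {E E' : Type*} [NormedAddCommGroup E] [NormedAddCommGroup E']

theorem Controlled.of_norm_le (hfin : ∀ N, 0 < N → Finite (G ⧸ transPow G N))
    {f : Uper G → G → E}
    (hper : ∀ N u, IsPeriodicWith G N (Uper.val u) → IsPeriodicWith G N (f u))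
    (hle : ∀ u g, ‖f u g‖ ≤ defect x₀ R u g) : Controlled x₀ R f := by
  refine ⟨hper, 1, zero_le_one, fun N hN u _ => ?_⟩
  have := hfin N hN
  rw [one_mul]
  refine cellMean_mono fun g => ?_
  gcongr
  exact hle u g

theorem Controlled.zero (hfin : ∀ N, 0 < N → Finite (G ⧸ transPow G N)) :
    Controlled x₀ R fun _ _ => (0 : E) :=
  .of_norm_le hfin (fun _ _ _ _ _ _ => rfl) fun _ _ => by rw [norm_zero]; exact norm_nonneg _

theorem Controlled.add (hfin : ∀ N, 0 < N → Finite (G ⧸ transPow G N))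
    {f f' : Uper G → G → E} (hf : Controlled x₀ R f) (hf' : Controlled x₀ R f') :
    Controlled x₀ R fun u g => f u g + f' u g := by
  obtain ⟨hp, C, hC, h⟩ := hf
  obtain ⟨hp', C', hC', h'⟩ := hf'
  refine ⟨fun N u hu => (hp N u hu).comp₂ (hp' N u hu) (· + ·), 2 * (C + C'), by positivity,
    fun N hN u hu => ?_⟩
  have := hfin N hN
  calc cellMean G N (fun g => ‖f u g + f' u g‖ ^ 2)
      ≤ cellMean G N (fun g => 2 * (‖f u g‖ ^ 2 + ‖f' u g‖ ^ 2)) := by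
        refine cellMean_mono fun g => ?_
        refine (pow_le_pow_left₀ (norm_nonneg _) (norm_add_le _ _) 2).trans ?_
        exact add_sq_le
    _ ≤ 2 * (C + C') * cellMean G N fun g => defect x₀ R u g ^ 2 := by
        rw [cellMean_const_mul, cellMean_add]
        linarith [h N hN u hu, h' N hN u hu]

theorem Controlled.shift {f : Uper G → G → E} (hf : Controlled x₀ R f) (k : G) :
    Controlled x₀ R fun u g => f u (g * k) := by
  obtain ⟨hp, C, hC, h⟩ := hf
  refine ⟨fun N u hu => (hp N u hu).shift k, C, hC, fun N hN u hu => ?_⟩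
  rw [cellMean_shift ((hp N u hu).comp fun x => ‖x‖ ^ 2)]
  exact h N hN u hu

theorem Controlled.sum (hfin : ∀ N, 0 < N → Finite (G ⧸ transPow G N)) {ι : Type*}
    (s : Finset ι) {f : ι → Uper G → G → E} (hf : ∀ i, Controlled x₀ R (f i)) :
    Controlled x₀ R fun u g => ∑ i ∈ s, f i u g := by
  classical
  induction s using Finset.induction_on with
  | empty => simpa using Controlled.zero hfin
  | insert i s hi ih => simpa only [Finset.sum_insert hi] using (hf i).add hfin ih

variable [NormedSpace ℝ E] [NormedSpace ℝ E']

theorem Controlled.map (hfin : ∀ N, 0 < N → Finite (G ⧸ transPow G N)) {f : Uper G → G → E}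
    (hf : Controlled x₀ R f) (L : E →L[ℝ] E') : Controlled x₀ R fun u g => L (f u g) := by
  obtain ⟨hp, C, hC, h⟩ := hf
  refine ⟨fun N u hu => (hp N u hu).comp L, ‖L‖ ^ 2 * C, by positivity, fun N hN u hu => ?_⟩
  have := hfin N hN
  calc cellMean G N (fun g => ‖L (f u g)‖ ^ 2)
      ≤ cellMean G N (fun g => ‖L‖ ^ 2 * ‖f u g‖ ^ 2) := by
        refine cellMean_mono fun g => ?_
        rw [← mul_pow]
        gcongr
        exact L.le_opNorm _
    _ ≤ ‖L‖ ^ 2 * C * cellMean G N fun g => defect x₀ R u g ^ 2 := by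
        rw [cellMean_const_mul, mul_assoc]
        gcongr
        exact h N hN u hu

theorem Controlled.const_smul (hfin : ∀ N, 0 < N → Finite (G ⧸ transPow G N))
    {f : Uper G → G → E} (hf : Controlled x₀ R f) (c : ℝ) :
    Controlled x₀ R fun u g => c • f u g :=
  hf.map hfin (c • ContinuousLinearMap.id ℝ E)

theorem Controlled.sub (hfin : ∀ N, 0 < N → Finite (G ⧸ transPow G N))
    {f f' : Uper G → G → E} (hf : Controlled x₀ R f) (hf' : Controlled x₀ R f') :
    Controlled x₀ R fun u g => f u g - f' u g := by
  simpa [sub_eq_add_neg] using hf.add hfin (hf'.const_smul hfin (-1))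

theorem Controlled.rot (hfin : ∀ N, 0 < N → Finite (G ⧸ transPow G N)) {f : Uper G → G → Pt d}
    (hf : Controlled x₀ R f) (k : EucGroup d) : Controlled x₀ R fun u g => rot k (f u g) :=
  hf.map hfin (ObjStruct.rot k).toContinuousLinearEquiv.toContinuousLinearMap

/-- Control is asked at each fixed `x`, with a constant that may depend on `x`, so closure under
linear combinations suffices. -/
theorem Controlled.of_span (hfin : ∀ N, 0 < N → Finite (G ⧸ transPow G N)) {ι : Type*}
    {b : ι → E} (hb : ⊤ ≤ Submodule.span ℝ (Set.range b)) {F : Uper G → G → E →ₗ[ℝ] E'}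
    (hF : ∀ i, Controlled x₀ R fun u g => F u g (b i)) (x : E) :
    Controlled x₀ R fun u g => F u g x := by
  induction hb (Submodule.mem_top : x ∈ ⊤) using Submodule.span_induction with
  | mem y hy =>
    obtain ⟨i, rfl⟩ := hy
    exact hF i
  | zero => simpa using Controlled.zero hfin
  | add y z _ _ hy hz => simpa using hy.add hfin hz
  | smul c y _ hy => simpa using hy.const_smul hfin c

theorem Controlled.of_affineSpan (hfin : ∀ N, 0 < N → Finite (G ⧸ transPow G N)) {s : Set (Pt d)}
    {F : Uper G → G → Pt d →ᵃ[ℝ] Pt d} (hF : ∀ y ∈ s, Controlled x₀ R fun u g => F u g y)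
    {x : Pt d} (hx : x ∈ affineSpan ℝ s) : Controlled x₀ R fun u g => F u g x := by
  refine affineSpan_induction (p := fun x => Controlled x₀ R fun u g => F u g x) hx hF ?_
  intro c y z w hy hz hw
  convert ((hy.sub hfin hz).const_smul hfin c).add hfin hw using 3 with u g
  rw [AffineMap.map_vadd, map_smul, AffineMap.linearMap_vsub]
  rfl

/-- A family of locally best rigid displacements for `u`. -/
noncomputable def rigidFit (x₀ : Pt d) (R : Finset G) (u : Uper G) (g : G) : Pt d →ᵃ[ℝ] Pt d :=
  (exists_rigid_fit x₀ R (localRestrict R u g)).choose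

theorem rigidFit_skew (u : Uper G) (g : G) (x y : Pt d) :
    inner ℝ x ((rigidFit x₀ R u g).linear y) + inner ℝ y ((rigidFit x₀ R u g).linear x) = 0 :=
  (exists_rigid_fit x₀ R (localRestrict R u g)).choose_spec.1 x y

theorem isPeriodicWith_rigidFit {N : ℕ} {u : Uper G} (hu : IsPeriodicWith G N u.val) :
    IsPeriodicWith G N (rigidFit x₀ R u) :=
  (isPeriodicWith_localRestrict hu).comp fun v => (exists_rigid_fit x₀ R v).choose

theorem controlled_sub_rigidFit_of_mem (hfin : ∀ N, 0 < N → Finite (G ⧸ transPow G N)) {h : G}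
    (hh : h ∈ R) : Controlled x₀ R fun u g =>
      rot (h : EucGroup d) (u.val (g * h)) - rigidFit x₀ R u g ((h : EucGroup d) x₀) := by
  refine .of_norm_le hfin (fun N u hu => (hu.shift h).comp₂ (isPeriodicWith_rigidFit hu)
    fun x J => rot (h : EucGroup d) x - J ((h : EucGroup d) x₀)) fun u g => ?_
  exact (exists_rigid_fit x₀ R (localRestrict R u g)).choose_spec.2 ⟨h, hh⟩

/-- The transition between the rigid fits at `g` and `gk`. -/
theorem controlled_transition (hfin : ∀ N, 0 < N → Finite (G ⧸ transPow G N))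
    (hR : PropertyTwo x₀ (R : Set G)) (k h : G) : Controlled x₀ R fun u g =>
      rot (k : EucGroup d) (rigidFit x₀ R u (g * k) ((h : EucGroup d) x₀)) -
        rigidFit x₀ R u g (((k * h : G) : EucGroup d) x₀) := by
  obtain ⟨-, R', R'', h1, hgen, ⟨-, -, hspan⟩, hsub⟩ := hR
  -- The statement is generalized over `h`: the product and inverse cases use it at `k₂ h` and `k⁻¹
  -- h`.
  induction (hgen ▸ Subgroup.mem_top k : k ∈ Subgroup.closure R') using Subgroup.closure_induction
    generalizing h with
  | mem r hr =>
    have hmem : (h : EucGroup d) x₀ ∈ affineSpan ℝ ((fun g : G => (g : EucGroup d) x₀) '' R'') := by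
      rw [hspan]
      exact subset_affineSpan ℝ _ ⟨h, rfl⟩
    let F : Uper G → G → Pt d →ᵃ[ℝ] Pt d := fun u g =>
      ((rot (r : EucGroup d)).toLinearEquiv : Pt d →ₗ[ℝ] Pt d).toAffineMap.comp
        (rigidFit x₀ R u (g * r)) -
      (rigidFit x₀ R u g).comp ((r : EucGroup d).toAffineEquiv : Pt d →ᵃ[ℝ] Pt d)
    refine Controlled.of_affineSpan (F := F) hfin ?_ hmem
    -- For `k ∈ R''` both `r k` and `k = 1 k` lie in `R`, so the fits at `g` and at `g r` both
    -- approximate the value of `u` at `g r k`; subtracting eliminates `u`. Equality of the affine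
    -- hulls carries this over to every `h`.
    rintro _ ⟨k, hk, rfl⟩
    have c1 := controlled_sub_rigidFit_of_mem (x₀ := x₀) hfin (hsub r hr k hk)
    have c2 := ((controlled_sub_rigidFit_of_mem (x₀ := x₀) hfin (one_mul k ▸ hsub 1 h1 k hk)).shift
      r).rot hfin r
    convert c1.sub hfin c2 using 3 with u g
    rw [map_sub, Subgroup.coe_mul, rot_mul, ← mul_assoc]
    simp only [F]
    change rot (r : EucGroup d) _ - _ = _
    change _ = rot (r : EucGroup d) (rot (k : EucGroup d) _) - _ -
      (rot (r : EucGroup d) (rot (k : EucGroup d) _) - _)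
    rw [sub_sub_sub_cancel_left]
    rfl
  | one =>
    convert Controlled.zero (x₀ := x₀) (R := R) (E := Pt d) hfin using 3 with u g
    rw [mul_one, one_mul]
    exact sub_self _
  | mul k₁ k₂ _ _ ih₁ ih₂ =>
    convert ((ih₂ h).shift k₁ |>.rot hfin k₁).add hfin (ih₁ (k₂ * h)) using 3 with u g
    rw [map_sub, Subgroup.coe_mul, rot_mul, mul_assoc g, mul_assoc k₁, sub_add_sub_cancel]
    rfl
  | inv k _ ih =>
    convert (((ih (k⁻¹ * h)).shift k⁻¹).rot hfin ((k⁻¹ : G) : EucGroup d)).const_smul hfin (-1)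
      using 3 with u g
    have hrot : ∀ x, rot ((k⁻¹ : G) : EucGroup d) (rot (k : EucGroup d) x) = x := fun x => by
      change (rot ((k⁻¹ : G) : EucGroup d) * rot (k : EucGroup d)) x = x
      rw [← rot_mul, ← Subgroup.coe_mul, inv_mul_cancel]
      rfl
    rw [map_sub, hrot, inv_mul_cancel_right, mul_inv_cancel_left, neg_smul, one_smul, neg_sub]

/-- The fit at `g` approximates `u` even far from `R`: compare `u(gh)` with the fit at `gh` at the
point `x₀`, using `1 ∈ R`, then pass to the fit at `g` by the transition estimate. -/
theorem controlled_sub_rigidFit (hfin : ∀ N, 0 < N → Finite (G ⧸ transPow G N))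
    (hR : PropertyTwo x₀ (R : Set G)) (h : G) : Controlled x₀ R fun u g =>
      rot (h : EucGroup d) (u.val (g * h)) - rigidFit x₀ R u g ((h : EucGroup d) x₀) := by
  have hR1 : (1 : G) ∈ R := by
    obtain ⟨-, R', R'', h1, -, ⟨-, h1', -⟩, hsub⟩ := hR
    simpa using hsub 1 h1 1 h1'
  convert (((controlled_sub_rigidFit_of_mem (x₀ := x₀) hfin hR1).shift h).rot hfin h).add hfin
    (controlled_transition hfin hR h 1) using 3 with u g
  rw [map_sub, mul_one, mul_one, sub_add_sub_cancel]
  rfl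

/-- By the discrete Korn inequality, the infinitesimal rotations are controlled. -/
theorem controlled_rigidFit_linear (hfin : ∀ N, 0 < N → Finite (G ⧸ transPow G N))
    (hG : IsSpaceGroup G) (hR : PropertyTwo x₀ (R : Set G)) (z : Pt d) :
    Controlled x₀ R fun u g => (rigidFit x₀ R u g).linear z := by
  obtain ⟨-, b, hb, hbG⟩ := hG
  have hspan : ⊤ ≤ Submodule.span ℝ (Set.range b) :=
    (hb.span_eq_top_of_card_eq_finrank' (by simp)).ge
  let t : Fin d → G := fun i => ⟨_, hbG i⟩
  have ht : ∀ i, t i ∈ translations G := fun i => constVAdd_mem_translations (hbG i)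
  have htr : ∀ i, rot (t i : EucGroup d) = 1 := ht
  have hcomm : ∀ i j, Commute (t i) (t j) := fun i j => translations_commute G (ht i) (ht j)
  have hstrain : ∀ i, Controlled x₀ R fun u g =>
      u.val (g * t i) - u.val g - (rigidFit x₀ R u g).linear (b i) := by
    intro i
    convert (controlled_sub_rigidFit hfin hR (t i)).sub hfin (controlled_sub_rigidFit hfin hR 1)
      using 3 with u g
    have h1 : rigidFit x₀ R u g ((t i : EucGroup d) x₀) =
        (rigidFit x₀ R u g).linear (b i) + rigidFit x₀ R u g x₀ :=
      (rigidFit x₀ R u g).map_vadd x₀ (b i)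
    rw [h1, htr, mul_one]
    change _ = u.val (g * t i) - _ - (u.val g - rigidFit x₀ R u g x₀)
    abel
  have hper : ∀ N (u : Uper G), IsPeriodicWith G N u.val → ∀ j,
      IsPeriodicWith G N fun g => inner ℝ (b j) (u.val g) :=
    fun N u hu j => hu.comp (inner ℝ (b j))
  -- The lattice vectors serve both as directions and as test vectors, so that the rotation terms
  -- `⟨bⱼ, S bᵢ⟩ + ⟨bᵢ, S bⱼ⟩` cancel by skewness.
  have hsym : ∀ i j, Controlled x₀ R fun u g =>
      (inner ℝ (b j) (u.val (g * t i)) - inner ℝ (b j) (u.val g)) +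
        (inner ℝ (b i) (u.val (g * t j)) - inner ℝ (b i) (u.val g)) := by
    intro i j
    convert ((hstrain i).map hfin (innerSL ℝ (b j))).add hfin
      ((hstrain j).map hfin (innerSL ℝ (b i))) using 3 with u g
    have h0 := rigidFit_skew (x₀ := x₀) (R := R) u g (b i) (b j)
    simp only [innerSL_apply_apply, inner_sub_right]
    linarith
  have hgrad : ∀ i j, Controlled x₀ R fun u g =>
      (inner ℝ (b j) (u.val (g * t i)) - inner ℝ (b j) (u.val g) : ℝ) := by
    intro i j
    -- Korn bounds only the sum over all pairs, so the constant for one pair is the sum of all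
    -- symmetric constants.
    choose hp C hC h using hsym
    refine ⟨fun N u hu => ((hper N u hu j).shift (t i)).comp₂ (hper N u hu j) (· - ·),
      ∑ i, ∑ j, C i j, Finset.sum_nonneg fun i _ => Finset.sum_nonneg fun j _ => hC i j,
      fun N hN u hu => ?_⟩
    have := hfin N hN
    have hK := sum_cellMean_diff_sq_le (hper N u hu) hcomm
    simp only [Real.norm_eq_abs, sq_abs] at h ⊢
    have hs : ∀ i j, 0 ≤ cellMean G N (fun g =>
        (inner ℝ (b j) (u.val (g * t i)) - inner ℝ (b j) (u.val g)) ^ 2) :=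
      fun i j => cellMean_nonneg fun g => sq_nonneg _
    refine (Finset.single_le_sum (fun j _ => hs i j) (Finset.mem_univ j)).trans ?_
    refine (Finset.single_le_sum (f := fun i => ∑ j, cellMean G N (fun g =>
      (inner ℝ (b j) (u.val (g * t i)) - inner ℝ (b j) (u.val g)) ^ 2))
      (fun i _ => Finset.sum_nonneg fun j _ => hs i j) (Finset.mem_univ i)).trans (hK.trans ?_)
    simp only [Finset.sum_mul]
    exact Finset.sum_le_sum fun i _ => Finset.sum_le_sum fun j _ => h i j N hN u hu
  -- Gradient minus strain error leaves `⟨bⱼ, S bᵢ⟩`; linearity extends this from the lattice basis,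
  -- which need not be orthonormal, to every `y`.
  have hcoord : ∀ i y, Controlled x₀ R fun u g =>
      (inner ℝ y ((rigidFit x₀ R u g).linear (b i)) : ℝ) := by
    intro i y
    have := Controlled.of_span (x₀ := x₀) (R := R) hfin hspan
      (F := fun u g => (innerₗ (Pt d)).flip ((rigidFit x₀ R u g).linear (b i))) (fun j => by
        convert (hgrad i j).sub hfin ((hstrain i).map hfin (innerSL ℝ (b j))) using 3 with u g
        simp only [innerSL_apply_apply, inner_sub_right, LinearMap.flip_apply, innerₗ_apply_apply]
        ring) y
    exact this
  refine Controlled.of_span hfin hspan (F := fun u g => (rigidFit x₀ R u g).linear) (fun i => ?_) z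
  let e := EuclideanSpace.basisFun (Fin d) ℝ
  convert Controlled.sum hfin Finset.univ fun k =>
    (hcoord i (e k)).map hfin ((1 : ℝ →L[ℝ] ℝ).smulRight (e k)) using 3 with u g
  simpa using (e.sum_repr' ((rigidFit x₀ R u g).linear (b i))).symm

/-- The discrete derivatives are controlled by the seminorm `‖·‖_R`. -/
theorem controlled_diffCLM (hfin : ∀ N, 0 < N → Finite (G ⧸ transPow G N))
    (hG : IsSpaceGroup G) (hR : PropertyTwo x₀ (R : Set G)) (h : G) :
    Controlled x₀ R fun u g => diffCLM h g u := by
  convert ((controlled_sub_rigidFit hfin hR h).sub hfin (controlled_sub_rigidFit hfin hR 1)).add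
    hfin (controlled_rigidFit_linear hfin hG hR ((h : EucGroup d) x₀ - x₀)) using 3 with u g
  have h1 := (rigidFit x₀ R u g).linearMap_vsub ((h : EucGroup d) x₀) x₀
  rw [vsub_eq_sub, vsub_eq_sub] at h1
  rw [h1, diffCLM_apply, mul_one]
  change _ = _ - _ - (u.val g - rigidFit x₀ R u g x₀) + _
  abel

end Controlled

/-! ### Boundedness and finiteness of the stability constants -/

section Stability

variable {d : ℕ} {G : Subgroup (EucGroup d)} {x₀ : Pt d} {R : Finset G}

theorem seminormR_nonneg (u : Uper G) : 0 ≤ seminormR x₀ R u := Real.sqrt_nonneg _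

theorem sq_seminormR (hfin : ∀ N, 0 < N → Finite (G ⧸ transPow G N)) {N : ℕ} (hN : 0 < N)
    {u : Uper G} (hu : IsPeriodicWith G N u.val) :
    seminormR x₀ R u ^ 2 = cellMean G N fun g => defect x₀ R u g ^ 2 := by
  have := hfin N hN
  have hp : IsPeriodicWith G N fun g => defect x₀ R u g ^ 2 :=
    (isPeriodicWith_defect hu).comp (· ^ 2)
  have h := mean_eq_cellMean hfin hN hp
  have h0 : 0 ≤ cellMean G N fun g => defect x₀ R u g ^ 2 := cellMean_nonneg fun g => sq_nonneg _
  rw [← h] at h0 ⊢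
  exact Real.sq_sqrt h0

/-- Fewer admissible rotations give a smaller kernel, so projecting off the larger kernel factors
through projecting off the smaller one. -/
theorem seminormR_le_seminormRZeroZero (hfin : ∀ N, 0 < N → Finite (G ⧸ transPow G N)) (d₁ : ℕ)
    (u : Uper G) : seminormR x₀ R u ≤ seminormRZeroZero d₁ x₀ R u := by
  obtain ⟨N, hN, hu⟩ := u.2
  have := hfin N hN
  have hp : ∀ K, IsPeriodicWith G N fun g =>
      ‖(Uiso K x₀ R)ᗮ.starProjection (localRestrict R u g)‖ ^ 2 := fun K =>
    (isPeriodicWith_localRestrict hu).comp fun v => ‖(Uiso K x₀ R)ᗮ.starProjection v‖ ^ 2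
  unfold seminormR seminormRZeroZero rigidSeminorm
  rw [mean_eq_cellMean hfin hN (hp _), mean_eq_cellMean hfin hN (hp _)]
  refine Real.sqrt_le_sqrt (cellMean_mono fun g => ?_)
  gcongr
  have hle : (Uiso (skew d) x₀ R)ᗮ ≤ (Uiso (skewZeroZero d d₁) x₀ R)ᗮ := by
    refine Submodule.orthogonal_le (sup_le_sup_left ?_ _)
    rintro v ⟨S, hS, hv⟩
    exact ⟨S, hS.1, hv⟩
  have hcomp : (Uiso (skew d) x₀ R)ᗮ.starProjection (localRestrict R u g) =
      (Uiso (skew d) x₀ R)ᗮ.starProjection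
        ((Uiso (skewZeroZero d d₁) x₀ R)ᗮ.starProjection (localRestrict R u g)) :=
    (DFunLike.congr_fun (Submodule.starProjection_comp_starProjection_of_le hle) _).symm
  rw [hcomp]
  exact Submodule.norm_starProjection_apply_le _ _

theorem BoundedWrt.mono {B : Uper G →L[ℝ] Uper G →L[ℝ] ℝ} {p q : Uper G → ℝ}
    (hB : BoundedWrt B p) (hp : ∀ u, 0 ≤ p u) (hpq : ∀ u, p u ≤ q u) : BoundedWrt B q := by
  obtain ⟨C, hC, h⟩ := hB
  refine ⟨C, hC, fun u v => (h u v).trans ?_⟩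
  exact mul_le_mul (mul_le_mul_of_nonneg_left (hpq u) hC.le) (hpq v) (hp v)
    (mul_nonneg hC.le ((hp u).trans (hpq u)))

theorem boundedWrt_energyHess (hfin : ∀ N, 0 < N → Finite (G ⧸ transPow G N))
    (hG : IsSpaceGroup G) (hR : PropertyTwo x₀ (R : Set G)) {V : (NonId G → Pt d) → ℝ}
    {s : Finset G} {C : ℝ} (hC : 0 ≤ C)
    (h : ∀ N, 0 < N → ∀ u v : Uper G, IsPeriodicWith G N u.val → IsPeriodicWith G N v.val →
        |energyHess V x₀ u v| ≤ C * cellMean G N fun g =>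
          √(∑ h ∈ s, ‖diffCLM h g u‖ ^ 2) * √(∑ h ∈ s, ‖diffCLM h g v‖ ^ 2)) :
    BoundedWrt (energyHess V x₀) (seminormR x₀ R) := by
  choose K hK hKle using fun h => (controlled_diffCLM (x₀ := x₀) hfin hG hR h).2
  have hK0 : 0 ≤ ∑ h ∈ s, K h := Finset.sum_nonneg fun h _ => hK h
  have key : ∀ N, 0 < N → ∀ u : Uper G, IsPeriodicWith G N u.val →
      √(cellMean G N fun g => √(∑ h ∈ s, ‖diffCLM h g u‖ ^ 2) ^ 2) ≤
        √(∑ h ∈ s, K h) * seminormR x₀ R u := by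
    intro N hN u hu
    have := hfin N hN
    rw [← Real.sqrt_sq (seminormR_nonneg u), ← Real.sqrt_mul hK0, sq_seminormR hfin hN hu]
    refine Real.sqrt_le_sqrt ?_
    have hsq : ∀ g : G, √(∑ h ∈ s, ‖diffCLM h g u‖ ^ 2) ^ 2 = ∑ h ∈ s, ‖diffCLM h g u‖ ^ 2 :=
      fun g => Real.sq_sqrt (by positivity)
    simp only [hsq, cellMean_sum, Finset.sum_mul]
    exact Finset.sum_le_sum fun h _ => hKle h N hN u hu
  -- The summand `1` only makes the constant strictly positive.
  refine ⟨C * (∑ h ∈ s, K h) + 1, by positivity, fun u v => ?_⟩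
  obtain ⟨N, hN, hu⟩ := u.2
  obtain ⟨M, hM, hv⟩ := v.2
  have hNM := Nat.mul_pos hN hM
  have hu' : IsPeriodicWith G (N * M) u.val := hu.mul_right G M
  have hv' : IsPeriodicWith G (N * M) v.val := hv.mul_left N
  have := hfin _ hNM
  calc |energyHess V x₀ u v|
      ≤ C * ((√(∑ h ∈ s, K h) * seminormR x₀ R u) * (√(∑ h ∈ s, K h) * seminormR x₀ R v)) := by
        refine (h _ hNM u v hu' hv').trans (mul_le_mul_of_nonneg_left ?_ hC)
        refine (cellMean_mul_le _ _).trans (mul_le_mul (key _ hNM u hu') (key _ hNM v hv')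
          (Real.sqrt_nonneg _) (mul_nonneg (Real.sqrt_nonneg _) (seminormR_nonneg u)))
    _ = C * (∑ h ∈ s, K h) * (seminormR x₀ R u * seminormR x₀ R v) := by
        rw [mul_mul_mul_comm, Real.mul_self_sqrt hK0]
        ring
    _ ≤ (C * (∑ h ∈ s, K h) + 1) * seminormR x₀ R u * seminormR x₀ R v := by
        have := mul_nonneg (seminormR_nonneg (x₀ := x₀) (R := R) u)
          (seminormR_nonneg (x₀ := x₀) (R := R) v)
        linarith

theorem stabilityConst_real {B : Uper G →L[ℝ] Uper G →L[ℝ] ℝ} {p : Uper G → ℝ}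
    (hB : BoundedWrt B p) {u : Uper G} (hu : 0 < p u) : ∃ r : ℝ, stabilityConst B p = r := by
  obtain ⟨C, -, hC⟩ := hB
  have hlow : ((-C : ℝ) : EReal) ≤ stabilityConst B p := by
    refine le_sSup ⟨-C, fun v => ?_, rfl⟩
    have := (abs_le.1 (hC v v)).1
    linarith
  have hup : stabilityConst B p ≤ ((B u u / p u ^ 2 : ℝ) : EReal) := by
    refine sSup_le ?_
    rintro _ ⟨c, hc, rfl⟩
    rw [EReal.coe_le_coe_iff, le_div_iff₀ (by positivity)]
    exact hc u
  refine ⟨(stabilityConst B p).toReal, (EReal.coe_toReal ?_ ?_).symm⟩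
  · exact (hup.trans_lt (EReal.coe_lt_top _)).ne
  · exact ((EReal.bot_lt_coe _).trans_le hlow).ne'

/-- A nonzero translation is not an `N`-th power of a translation for large `N`. -/
theorem exists_translation_not_mem_transPow (hd : 0 < d) (hG : IsSpaceGroup G) :
    ∃ t ∈ translations G, ∃ N, 0 < N ∧ t ∉ transPow G N := by
  obtain ⟨hdisc, b, hb, hbG⟩ := hG
  obtain ⟨ε, hε, hsep⟩ := exists_orbit_separated hdisc (0 : Pt d)
  set v := b ⟨0, hd⟩ with hv
  have hv0 : v ≠ 0 := hb.ne_zero _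
  -- An `N`-th root of the translation by `v` would move the origin by `‖v‖ / N < ε`, against the
  -- separation of the orbit.
  obtain ⟨N, hN⟩ := exists_nat_gt (‖v‖ / ε)
  have hN0 : 0 < N := by
    have : (0 : ℝ) < N := lt_of_le_of_lt (by positivity) hN
    exact_mod_cast this
  refine ⟨⟨_, hbG ⟨0, hd⟩⟩, constVAdd_mem_translations _, N, hN0, ?_⟩
  rintro ⟨s, hs, hst⟩
  have h1 : N • (s : EucGroup d) 0 = v := by
    have h := translation_pow_apply hs N 0
    rw [hst] at h
    simpa [eq_comm] using h
  have hs0 : (s : EucGroup d) 0 ≠ ((1 : G) : EucGroup d) 0 := by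
    intro h
    apply hv0
    rw [← h1, h]
    exact smul_zero N
  have h2 := hsep s 1 hs0
  have h3 : dist ((s : EucGroup d) 0) (((1 : G) : EucGroup d) 0) = ‖(s : EucGroup d) 0‖ :=
    dist_zero_right _
  have h4 : ‖v‖ = N * ‖(s : EucGroup d) 0‖ := by
    rw [← h1, ← Nat.cast_smul_eq_nsmul ℝ, norm_smul, Real.norm_natCast]
  rw [div_lt_iff₀ hε, h4] at hN
  have hN' : (0 : ℝ) < N := Nat.cast_pos.2 hN0
  rw [h3] at h2
  exact absurd hN (not_lt.2 (mul_le_mul_of_nonneg_left h2 hN'.le))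

open Classical in
/-- The function with value `e` on `T^N` and `0` elsewhere. -/
noncomputable def indicatorU (N : ℕ) (hN : 0 < N) (e : Pt d) : Uper G :=
  ⟨⟨fun g => if g ∈ transPow G N then e else 0, memℓp_infty ⟨‖e‖, by
    rintro _ ⟨g, rfl⟩
    beta_reduce
    split_ifs <;> simp⟩⟩, N, hN, fun g t ht => by
      simp only [Subgroup.mul_mem_cancel_right _ ht]⟩

theorem isPeriodicWith_indicatorU {N : ℕ} (hN : 0 < N) (e : Pt d) :
    IsPeriodicWith G N (indicatorU (G := G) N hN e).val := by
  classical
  intro g s hs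
  change (if g ∈ transPow G N then e else 0) = if g * s ∈ transPow G N then e else 0
  simp only [Subgroup.mul_mem_cancel_right _ hs]

/-- If the seminorm of the indicator of `T^N` vanished, the Korn estimate would annihilate its
discrete derivative along `t`; but the function takes the value `e` at `1` and `0` at `t`. -/
theorem exists_seminormR_pos (hd : 0 < d) (hfin : ∀ N, 0 < N → Finite (G ⧸ transPow G N))
    (hG : IsSpaceGroup G) (hR : PropertyTwo x₀ (R : Set G)) : ∃ u, 0 < seminormR x₀ R u := by
  obtain ⟨t, ht, N, hN, htN⟩ := exists_translation_not_mem_transPow hd hG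
  let e : Pt d := EuclideanSpace.single ⟨0, hd⟩ 1
  have he : e ≠ 0 := by simp [e]
  let u : Uper G := indicatorU N hN e
  have hu : IsPeriodicWith G N u.val := isPeriodicWith_indicatorU hN e
  refine ⟨u, (seminormR_nonneg u).lt_of_ne fun h0 => ?_⟩
  obtain ⟨hp, C, -, hC⟩ := controlled_diffCLM (x₀ := x₀) hfin hG hR t
  have := hfin N hN
  have h1 := hC N hN u hu
  rw [← sq_seminormR hfin hN hu, ← h0] at h1
  have h2 := eq_zero_of_cellMean_eq_zero ((hp N u hu).comp fun x => ‖x‖ ^ 2)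
    (fun g => sq_nonneg _) (h1.trans (by simp)) 1
  rw [sq_eq_zero_iff, norm_eq_zero] at h2
  beta_reduce at h2
  rw [diffCLM_apply, one_mul, sub_eq_zero] at h2
  have h3 : u.val t = 0 := if_neg htN
  have h4 : u.val 1 = e := if_pos (one_mem _)
  rw [h3, h4, map_zero] at h2
  exact he h2.symm

end Stability

end ObjStruct

theorem mainTheorem8 (d : ℕ) (hd : 0 < d)
    (G : Subgroup (ObjStruct.EucGroup d)) (hG : ObjStruct.IsSpaceGroup G)
    (x₀ : ObjStruct.Pt d)
    (hx₀ : Function.Injective fun g : G => (g : ObjStruct.EucGroup d) x₀)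
    (V : (ObjStruct.NonId G → ObjStruct.Pt d) → ℝ)
    (hV_inv : ObjStruct.IsOrthInvariant V)
    (hV_smooth : ObjStruct.IsSmoothPotential V)
    (hV_range : ObjStruct.HasFiniteRange V)
    (R : Finset G) (hR : ObjStruct.PropertyTwo x₀ (R : Set G)) :
    ContDiff ℝ 2 (ObjStruct.energy V) ∧
    ObjStruct.BoundedWrt (ObjStruct.energyHess V x₀) (ObjStruct.seminormR x₀ R) ∧
    ObjStruct.BoundedWrt (ObjStruct.energyHess V x₀) (ObjStruct.seminormRZeroZero 0 x₀ R) ∧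
    (∃ r : ℝ, ObjStruct.stabilityConst (ObjStruct.energyHess V x₀)
      (ObjStruct.seminormR x₀ R) = (r : EReal)) ∧
    (∃ r : ℝ, ObjStruct.stabilityConst (ObjStruct.energyHess V x₀)
      (ObjStruct.seminormRZeroZero 0 x₀ R) = (r : EReal)) := by
  have hfin : ∀ N, 0 < N → Finite (G ⧸ ObjStruct.transPow G N) :=
    fun N hN => ObjStruct.finite_quotient_transPow hG hx₀ hN
  obtain ⟨hE, s, C, hC, hs⟩ := ObjStruct.energy_regular hfin hV_inv hV_smooth hV_range x₀
  have hB := ObjStruct.boundedWrt_energyHess hfin hG hR hC hs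
  have hle := ObjStruct.seminormR_le_seminormRZeroZero (x₀ := x₀) (R := R) hfin 0
  have hB0 := hB.mono ObjStruct.seminormR_nonneg hle
  obtain ⟨u, hu⟩ := ObjStruct.exists_seminormR_pos hd hfin hG hR
  exact ⟨hE, hB, hB0, ObjStruct.stabilityConst_real hB hu,
    ObjStruct.stabilityConst_real hB0 (hu.trans_le (hle u))⟩
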